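/- Let $G$ be a lattice-ordered group (not necessarily abelian) and $(W,+)$ an abelian semigroup with a right action of $G$ by semigroup automorphisms. Let $(\Phi,h)$ be a weighted gain graph: a graph with finite vertex set $V$ and edge set $E$, whose edges may be links, loops, half edges (one endpoint) or loose edges (no endpoint), together with a gain $\varphi(e)\in G$ for every link and loop (inverted when the direction of $e$ is reversed) and a weight function $h:V\to W$. Switching by $\eta:V\to G$ replaces a gain $\varphi(e)$ from $v$ to $w$ by $\eta(v)^{-1}\varphi(e)\eta(w)$ and $h(v)$ by $h(v)\eta(v)$; the switched weighted gain graph is $(\Phi^\eta,h^\eta)$. For $S\subseteq E$ let $\pi_b(S)$ be the set of vertex sets of the balanced components of $(V,S)$ (those without half edges in which every circle has gain $1$) and let $V_b(S)$ be their union. The top switching function $\eta_S$ is the unique function on $V_b(S)$ such that $\varphi^{\eta_S}=1$ on every link and loop of $S$ in a balanced component and $\bigwedge_{v\in X}\eta_S(v)=1$ for every $X\in\pi_b(S)$. The deletion $(\Phi,h)\setminus S$ deletes the edges of $S$. The contraction $(\Phi,h)/S$ has vertex set $\pi_b(S)$ and edge set $E\setminus S$; it is obtained by switching by $\eta_S$,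 deleting the vertices outside $V_b(S)$ (an edge not in $S$ loses its deleted endpoints but remains), identifying each $X\in\pi_b(S)$ to a single vertex, and deleting $S$. The weight of the vertex $X$ is $\sum_{v\in X}h(v)\eta_S(v)$. Let $S=Q\cup R\subseteq E$ with $Q\cap R=\varnothing$. Then: 1. $((\Phi,h)/Q)/R=(\Phi,h)/S$, where each vertex $X\in\pi_b(S)$ of the right side is identified with the vertex $X''=\{Y\in\pi_b(Q): Y\subseteq X\}$ of the left side, so that $X=\bigcup X''$; this correspondence is a bijection of the vertex sets. 2. $((\Phi,h)/Q)\setminus R=((\Phi,h)\setminus R)/Q$. 3. $((\Phi,h)\setminus Q)\setminus R=(\Phi,h)\setminus S$. 4. $\eta_S(v)=\eta_Q(v)\,\eta'_S(v)$ for every $v\in V_b(S)$, where $\eta'_S$ is the top switching function for $S$ in $\Phi^{\eta_Q}$. (In particular this holds on all of $V$ when $S$ is balanced.) -/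

import Mathlib

/-- The incidences and the gain of one edge with vertices in `V` and gains in `G`: a loose edge has no
endpoint, a half edge has one endpoint, and an ordinary edge (a loop or a link) has two endpoints, which
may coincide. An ordinary edge is written in one (arbitrary) reference direction `arc v w g`, from `v`
to `w` with gain `g`; it is the same undirected edge as the one from `w` to `v` with gain `g⁻¹`. -/
inductive EdgeData (V : Type*) (G : Type*) where
  | loose : EdgeData V G
  | half (v : V) : EdgeData V G
  | arc (v w : V) (g : G) : EdgeData V G

namespace EdgeData

/-- The set of endpoints. -/
def ends {V G : Type*} : EdgeData V G → Set V
  | loose => ∅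
  | half v => {v}
  | arc v w _ => {v, w}

/-- Renaming the vertices. -/
def map {V V' G : Type*} (f : V → V') : EdgeData V G → EdgeData V' G
  | loose => loose
  | half v => half (f v)
  | arc v w g => arc (f v) (f w) g

/-- Switching: the gain `g` from `v` to `w` becomes `η(v)⁻¹ g η(w)`. -/
def switch {V G : Type*} [Group G] (η : V → G) : EdgeData V G → EdgeData V G
  | loose => loose
  | half v => half v
  | arc v w g => arc v w ((η v)⁻¹ * g * η w)

/-- Every vertex `v` with `p v = some x` is identified to `x`, and every vertex with `p v = none` is
deleted; an edge loses its deleted endpoints but remains (as a half or loose edge). -/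
def collapse {V V' G : Type*} (p : V → Option V') : EdgeData V G → EdgeData V' G
  | loose => loose
  | half v =>
    match p v with
    | some x => half x
    | none => loose
  | arc v w g =>
    match p v, p w with
    | some x, some y => arc x y g
    | some x, none => half x
    | none, some y => half y
    | none, none => loose

end EdgeData

/-- A gain graph with vertex set `V`, edge set `E` and gain group `G`. -/
structure GainGraph (V : Type*) (E : Type*) (G : Type*) where
  edge : E → EdgeData V G

namespace GainGraph

variable {V E G : Type*}

/-- The ordinary edge `e` can be traversed from `v` to `w`, and its gain in this direction is `g`. -/
def Traverses [Group G] (Φ : GainGraph V E G) (e : E) (v w : V) (g : G) : Prop :=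
  Φ.edge e = EdgeData.arc v w g ∨ Φ.edge e = EdgeData.arc w v g⁻¹

/-- `Φ.IsWalk v w vs es g`: there is a walk from `v` to `w` with sequence of edges `es`, whose
vertices other than the final vertex `w` are in order `vs`, and whose gain (the product of the gains of
its edges in the direction of the walk) is `g`. -/
inductive IsWalk [Group G] (Φ : GainGraph V E G) : V → V → List V → List E → G → Prop
  | nil (v : V) : IsWalk Φ v v [] [] 1
  | cons {e : E} {u v w : V} {g g' : G} {vs : List V} {es : List E} :
      Φ.Traverses e u v g → IsWalk Φ v w vs es g' → IsWalk Φ u w (u :: vs) (e :: es) (g * g')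

/-- An edge set `T` is balanced if it contains no half edge and every circle in it has gain `1`.
A circle, run through from one of its vertices, is a closed walk of positive length without repeated
edges and without repeated vertices (other than the equality of the first and the last). -/
def IsBalanced [Group G] (Φ : GainGraph V E G) (T : Set E) : Prop :=
  (∀ e ∈ T, ∀ v, Φ.edge e ≠ EdgeData.half v) ∧
  ∀ (v : V) (vs : List V) (es : List E) (g : G), Φ.IsWalk v v vs es g →
    es ≠ [] → vs.Nodup → es.Nodup → (∀ e ∈ es, e ∈ T) → g = 1

/-- Two vertices are joined by an ordinary edge of `S`. -/
def Adj (Φ : GainGraph V E G) (S : Set E) (v w : V) : Prop :=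
  ∃ e ∈ S, ∃ g, Φ.edge e = EdgeData.arc v w g

/-- Connectedness of two vertices in the spanning subgraph `(V, S)`. -/
def conn (Φ : GainGraph V E G) (S : Set E) : Setoid V := Relation.EqvGen.setoid (Φ.Adj S)

/-- The vertex set of the component of `(V, S)` that contains `v`. -/
def part (Φ : GainGraph V E G) (S : Set E) (v : V) : Set V := {w | (Φ.conn S).r w v}

/-- The partition `π(S)` of `V` into the vertex sets of the components of `(V, S)`. -/
def parts (Φ : GainGraph V E G) (S : Set E) : Set (Set V) := (Φ.conn S).classes

/-- The induced part `S:W` of `S`: the edges in `S` that have an endpoint in `W` and no endpoint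
outside `W`. -/
def induced (Φ : GainGraph V E G) (S : Set E) (W : Set V) : Set E :=
  {e ∈ S | (Φ.edge e).ends.Nonempty ∧ (Φ.edge e).ends ⊆ W}

/-- `π_b(S)`: the vertex sets of the balanced components of `(V, S)`. -/
def balancedParts [Group G] (Φ : GainGraph V E G) (S : Set E) : Set (Set V) :=
  {W ∈ Φ.parts S | Φ.IsBalanced (Φ.induced S W)}

/-- `V_b(S)`: the set of vertices of the balanced components of `(V, S)`. -/
def balancedVerts [Group G] (Φ : GainGraph V E G) (S : Set E) : Set V := ⋃₀ Φ.balancedParts S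

/-- Switching a gain graph. -/
def switch [Group G] (Φ : GainGraph V E G) (η : V → G) : GainGraph V E G where
  edge e := (Φ.edge e).switch η

/-- Deleting the edge set `S`. -/
def delete (Φ : GainGraph V E G) (S : Set E) : GainGraph V {e // e ∉ S} G where
  edge e := Φ.edge e

/-- `η` is a top switching function for (the balanced components of) `S`: it switches all gains in
the balanced components of `S` to `1`, and the meet of its values on each `W ∈ π_b(S)` is `1`.
When `S` is not balanced, the vertices outside `V_b(S)` are irrelevant, and `η` has value `1` there. -/
structure IsTopSwitching [Group G] [Lattice G] (Φ : GainGraph V E G) (S : Set E) (η : V → G) :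
    Prop where
  switching : ∀ e ∈ S, ∀ v w g, Φ.edge e = EdgeData.arc v w g → v ∈ Φ.balancedVerts S →
    (η v)⁻¹ * g * η w = 1
  meet : ∀ W ∈ Φ.balancedParts S, IsGLB (η '' W) 1
  off : ∀ v ∉ Φ.balancedVerts S, η v = 1

section Existence

theorem mem_part_self (Φ : GainGraph V E G) (S : Set E) (v : V) : v ∈ Φ.part S v :=
  (Φ.conn S).refl v

theorem part_mem_parts (Φ : GainGraph V E G) (S : Set E) (v : V) : Φ.part S v ∈ Φ.parts S :=
  ⟨v, rfl⟩

theorem part_eq_of_mem {Φ : GainGraph V E G} {S : Set E} {W : Set V} {v : V}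
    (hW : W ∈ Φ.parts S) (hv : v ∈ W) : Φ.part S v = W :=
  Setoid.eq_of_mem_classes (part_mem_parts Φ S v) (mem_part_self Φ S v) hW hv

theorem nonempty_of_mem_parts {Φ : GainGraph V E G} {S : Set E} {W : Set V}
    (hW : W ∈ Φ.parts S) : W.Nonempty := by
  obtain ⟨y, rfl⟩ := hW
  exact ⟨y, (Φ.conn S).refl y⟩

theorem part_eq_of_arc {Φ : GainGraph V E G} {S : Set E} {e : E} {v w : V} {g : G}
    (he : e ∈ S) (h : Φ.edge e = EdgeData.arc v w g) : Φ.part S v = Φ.part S w :=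
  part_eq_of_mem (part_mem_parts Φ S w) (Relation.EqvGen.rel _ _ ⟨e, he, g, h⟩)

variable [Group G]

theorem Traverses.symm {Φ : GainGraph V E G} {e : E} {v w : V} {g : G} (h : Φ.Traverses e v w g) :
    Φ.Traverses e w v g⁻¹ := by
  rcases h with h | h
  · right; simpa using h
  · left; exact h

theorem Traverses.ends {Φ : GainGraph V E G} {e : E} {v w : V} {g : G} (h : Φ.Traverses e v w g) :
    (Φ.edge e).ends = {v, w} := by
  rcases h with h | h
  · rw [h]; rfl
  · rw [h]; exact Set.pair_comm _ _

theorem IsWalk.append {Φ : GainGraph V E G} {u v : V} {vs : List V} {es : List E} {g : G}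
    (h : Φ.IsWalk u v vs es g) : ∀ {w : V} {vs' : List V} {es' : List E} {g' : G},
    Φ.IsWalk v w vs' es' g' → Φ.IsWalk u w (vs ++ vs') (es ++ es') (g * g') := by
  induction h with
  | nil v => intro w vs' es' g' h'; simpa using h'
  | cons ht _ ih => intro w vs' es' g' h'; rw [mul_assoc]; exact IsWalk.cons ht (ih h')

theorem IsWalk.ends_mem {Φ : GainGraph V E G} {u v : V} {vs : List V} {es : List E} {g : G}
    (h : Φ.IsWalk u v vs es g) : ∀ e ∈ es, ∀ x ∈ (Φ.edge e).ends, x ∈ vs ++ [v] := by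
  induction h with
  | nil v => intro e he; cases he
  | @cons e u v w g g' vs es ht hw ih =>
    intro e' he' x hx
    rcases List.mem_cons.1 he' with rfl | he'
    · rw [ht.ends] at hx
      rcases hx with rfl | rfl
      · simp
      · cases hw <;> simp
    · have := ih e' he' x hx
      exact List.mem_cons_of_mem _ this

/-- Splitting a walk at one of its vertices. -/
theorem IsWalk.split {Φ : GainGraph V E G} {u v : V} {vs : List V} {es : List E} {g : G}
    (h : Φ.IsWalk u v vs es g) : ∀ x ∈ vs ++ [v], ∃ vs₁ es₁ g₁ vs₂ es₂ g₂,
      Φ.IsWalk u x vs₁ es₁ g₁ ∧ Φ.IsWalk x v vs₂ es₂ g₂ ∧ vs = vs₁ ++ vs₂ ∧ es = es₁ ++ es₂ ∧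
        g = g₁ * g₂ := by
  induction h with
  | nil v =>
    intro x hx
    obtain rfl : x = v := by simpa using hx
    exact ⟨[], [], 1, [], [], 1, .nil _, .nil _, rfl, rfl, by simp⟩
  | @cons e u v w g g' vs es ht hw ih =>
    intro x hx
    by_cases hxu : x = u
    · subst hxu
      exact ⟨[], [], 1, _, _, _, .nil _, .cons ht hw, rfl, rfl, by simp⟩
    · have hx' : x ∈ vs ++ [w] := by
        rcases List.mem_cons.1 hx with h | h
        · exact absurd h hxu
        · exact h
      obtain ⟨vs₁, es₁, g₁, vs₂, es₂, g₂, h1, h2, rfl, rfl, rfl⟩ := ih x hx'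
      exact ⟨_, _, _, _, _, _, .cons ht h1, h2, rfl, rfl, by simp [mul_assoc]⟩

theorem IsWalk.eq_nil {Φ : GainGraph V E G} {u : V} {vs : List V} {es : List E} {g : G}
    (h : Φ.IsWalk u u vs es g) (hn : (vs ++ [u]).Nodup) : vs = [] ∧ es = [] ∧ g = 1 := by
  cases h with
  | nil => simp
  | cons ht hw => simp at hn

/-- In a balanced edge set every walk can be replaced by a path with the same gain. -/
theorem IsBalanced.exists_path {Φ : GainGraph V E G} {T : Set E} (hT : Φ.IsBalanced T)
    {u v : V} {vs : List V} {es : List E} {g : G}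
    (h : Φ.IsWalk u v vs es g) : (∀ e ∈ es, e ∈ T) → ∃ vs' es', Φ.IsWalk u v vs' es' g ∧
      (∀ e ∈ es', e ∈ T) ∧ (vs' ++ [v]).Nodup ∧ es'.Nodup := by
  induction h with
  | nil v => intro _; exact ⟨[], [], .nil _, by simp, by simp, by simp⟩
  | @cons e u v w g g' vs es ht hw ih =>
    intro hes
    obtain ⟨vs', es', hw', hT', hn, hne⟩ := ih (fun e' h' => hes e' (List.mem_cons_of_mem _ h'))
    have heT : e ∈ T := hes e List.mem_cons_self
    by_cases hu : u ∈ vs' ++ [w]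
    · obtain ⟨vs₁, es₁, g₁, vs₂, es₂, g₂, h1, h2, rfl, rfl, rfl⟩ := hw'.split u hu
      have hn₂ : (vs₂ ++ [w]).Nodup := by
        rw [List.append_assoc] at hn; exact (List.nodup_append.1 hn).2.1
      have hne₂ : es₂.Nodup := (List.nodup_append.1 hne).2.1
      have hne₁ : es₁.Nodup := (List.nodup_append.1 hne).1
      have hu₂ : u ∈ vs₂ ++ [w] := by cases h2 <;> simp
      have hn₁ : (vs₁ ++ [u]).Nodup := by
        rw [List.append_assoc] at hn
        have := List.nodup_append.1 hn
        refine List.nodup_append.2 ⟨this.1, by simp, ?_⟩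
        intro a ha b hb
        obtain rfl : b = u := by simpa using hb
        exact this.2.2 a ha b hu₂
      have key : g * g₁ = 1 := by
        by_cases he : e ∈ es₁
        · cases h1 with
          | nil => cases he
          | @cons e' _ v' _ k k' vs₃ es₃ ht' hw₃ =>
            have hv : v ∉ vs₃ ++ [u] := by
              have : (v :: (vs₃ ++ [u])).Nodup := hn₁
              exact (List.nodup_cons.1 this).1
            have hvu : v ≠ u := fun h => hv (by simp [h])
            rcases List.mem_cons.1 he with rfl | he
            · have hh : v' = u ∧ k = g⁻¹ := by
                rcases ht with h | h <;> rcases ht' with h' | h' <;> rw [h] at h' <;>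
                  injection h' with a b c
                · exact absurd a.symm hvu
                · exact ⟨a.symm, by rw [c, inv_inv]⟩
                · exact ⟨b.symm, c.symm⟩
                · exact absurd b.symm hvu
              obtain ⟨rfl, rfl⟩ := hh
              have hn₃ : (vs₃ ++ [v']).Nodup := by
                have : (v :: (vs₃ ++ [v'])).Nodup := hn₁
                exact (List.nodup_cons.1 this).2
              obtain ⟨-, -, rfl⟩ := hw₃.eq_nil hn₃
              simp
            · exact absurd (hw₃.ends_mem e he v (by rw [ht.ends]; simp)) hv
        · refine hT.2 u _ _ _ (IsWalk.cons ht h1) (by simp) ?_ ?_ ?_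
          · refine List.nodup_cons.2 ⟨?_, (List.nodup_append.1 hn₁).1⟩
            intro hmem
            exact (List.nodup_append.1 hn₁).2.2 u hmem u (by simp) rfl
          · exact List.nodup_cons.2 ⟨he, hne₁⟩
          · intro e' he'
            rcases List.mem_cons.1 he' with rfl | he'
            · exact heT
            · exact hT' e' (by simp [he'])
      refine ⟨vs₂, es₂, ?_, fun e' he' => hT' e' (by simp [he']), hn₂, hne₂⟩
      rw [← mul_assoc, key, one_mul]; exact h2
    · refine ⟨u :: vs', e :: es', .cons ht hw', ?_, ?_, ?_⟩
      · intro e' he'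
        rcases List.mem_cons.1 he' with rfl | he'
        · exact heT
        · exact hT' e' he'
      · exact List.nodup_cons.2 ⟨hu, hn⟩
      · refine List.nodup_cons.2 ⟨fun he => hu ?_, hne⟩
        exact hw'.ends_mem e he u (by rw [ht.ends]; simp)

theorem IsBalanced.closed_walk {Φ : GainGraph V E G} {T : Set E} (hT : Φ.IsBalanced T)
    {u : V} {vs : List V} {es : List E} {g : G}
    (h : Φ.IsWalk u u vs es g) (hes : ∀ e ∈ es, e ∈ T) : g = 1 := by
  obtain ⟨vs', es', h', -, hn, -⟩ := hT.exists_path h hes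
  exact (h'.eq_nil hn).2.2

theorem IsWalk.reverse {Φ : GainGraph V E G} {u v : V} {vs : List V} {es : List E} {g : G}
    (h : Φ.IsWalk u v vs es g) : ∃ vs' es', Φ.IsWalk v u vs' es' g⁻¹ ∧ ∀ e ∈ es', e ∈ es := by
  induction h with
  | nil v => exact ⟨[], [], by simpa using IsWalk.nil v, by simp⟩
  | @cons e u v w g g' vs es ht hw ih =>
    obtain ⟨vs', es', h', hs⟩ := ih
    refine ⟨vs' ++ [v], es' ++ [e], ?_, ?_⟩
    · rw [mul_inv_rev]
      have h1 := h'.append (IsWalk.cons ht.symm (.nil u))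
      rw [mul_one] at h1
      exact h1
    · intro e' he'
      rcases List.mem_append.1 he' with h | h
      · exact List.mem_cons_of_mem _ (hs e' h)
      · simp at h; simp [h]

theorem mem_balancedVerts_iff {Φ : GainGraph V E G} {S : Set E} {v : V} :
    v ∈ Φ.balancedVerts S ↔ Φ.part S v ∈ Φ.balancedParts S := by
  constructor
  · rintro ⟨W, hW, hv⟩
    rw [part_eq_of_mem hW.1 hv]; exact hW
  · intro h; exact ⟨_, h, mem_part_self Φ S v⟩

/-- Two vertices of a component are joined by a walk inside the component. -/
theorem exists_walk {Φ : GainGraph V E G} {S : Set E} {v w : V} (h : (Φ.conn S).r v w) :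
    ∃ vs es g, Φ.IsWalk v w vs es g ∧ ∀ e ∈ es, e ∈ Φ.induced S (Φ.part S w) := by
  induction h with
  | rel x y h =>
    obtain ⟨e, he, g, hg⟩ := h
    refine ⟨_, _, _, .cons (.inl hg) (.nil _), ?_⟩
    intro e' he'
    obtain rfl : e' = e := by simpa using he'
    refine ⟨he, ?_, ?_⟩
    · rw [hg]; exact ⟨x, by simp [EdgeData.ends]⟩
    · rw [hg]
      rintro z (rfl | rfl)
      · rw [← part_eq_of_arc he hg]; exact mem_part_self Φ S _
      · exact mem_part_self Φ S _
  | refl x => exact ⟨_, _, _, .nil _, by simp⟩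
  | symm x y h ih =>
    obtain ⟨vs, es, g, hw, hs⟩ := ih
    obtain ⟨vs', es', h', hs'⟩ := hw.reverse
    have : Φ.part S x = Φ.part S y := part_eq_of_mem (part_mem_parts Φ S y) h
    exact ⟨_, _, _, h', fun e he => this ▸ hs e (hs' e he)⟩
  | trans x y z h h' ih ih' =>
    obtain ⟨vs, es, g, hw, hs⟩ := ih
    obtain ⟨vs', es', g', hw', hs'⟩ := ih'
    have : Φ.part S y = Φ.part S z := part_eq_of_mem (part_mem_parts Φ S z) h'
    refine ⟨_, _, _, hw.append hw', fun e he => ?_⟩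
    rcases List.mem_append.1 he with he | he
    · exact this ▸ hs e he
    · exact hs' e he

/-- A switching function for the balanced components of `S` exists. -/
theorem exists_potential (Φ : GainGraph V E G) (S : Set E) :
    ∃ p : V → G, ∀ e ∈ S, ∀ v w g, Φ.edge e = EdgeData.arc v w g → v ∈ Φ.balancedVerts S →
      (p v)⁻¹ * g * p w = 1 := by
  classical
  have hroot : ∀ W : Set V, ∃ r : V → V, ∀ v, v ∈ W → r v ∈ W ∧ ∀ w ∈ W, r v = r w := by
    intro W
    by_cases hW : W.Nonempty
    · obtain ⟨x, hx⟩ := hW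
      exact ⟨fun _ => x, fun v _ => ⟨hx, fun _ _ => rfl⟩⟩
    · exact ⟨id, fun v hv => absurd ⟨v, hv⟩ hW⟩
  choose r hr using hroot
  let root : V → V := fun v => r (Φ.part S v) v
  have hroot : ∀ v, root v ∈ Φ.part S v := fun v => (hr _ v (mem_part_self Φ S v)).1
  have hex : ∀ v, ∃ g vs es, Φ.IsWalk v (root v) vs es g ∧
      ∀ e ∈ es, e ∈ Φ.induced S (Φ.part S v) := by
    intro v
    obtain ⟨vs, es, g, h, hs⟩ := exists_walk ((Φ.conn S).symm (hroot v))
    have : Φ.part S (root v) = Φ.part S v := part_eq_of_mem (part_mem_parts Φ S v) (hroot v)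
    exact ⟨g, vs, es, h, fun e he => this ▸ hs e he⟩
  choose p vs es hp hs using hex
  refine ⟨p, ?_⟩
  intro e he v w g hg hv
  have hpart : Φ.part S v = Φ.part S w := part_eq_of_arc he hg
  have hrt : root v = root w := by
    have h1 : w ∈ Φ.part S v := hpart ▸ mem_part_self Φ S w
    have := (hr (Φ.part S v) v (mem_part_self Φ S v)).2 w h1
    change r (Φ.part S v) v = r (Φ.part S w) w
    rw [← hpart]; exact this
  have hbal := (mem_balancedVerts_iff.1 hv).2
  obtain ⟨vs', es', hrev, hsub⟩ := (hp v).reverse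
  have hw2 : Φ.IsWalk v (root v) (v :: vs w) (e :: es w) (g * p w) := by
    have := IsWalk.cons (Or.inl hg : Φ.Traverses e v w g) (hp w)
    rw [← hrt] at this
    exact this
  have hcl := hrev.append hw2
  rw [mul_assoc]
  refine hbal.closed_walk hcl ?_
  intro e' he'
  rcases List.mem_append.1 he' with h | h
  · exact hs v e' (hsub e' h)
  · rcases List.mem_cons.1 h with rfl | h
    · refine ⟨he, ?_, ?_⟩
      · rw [hg]; exact ⟨v, by simp [EdgeData.ends]⟩
      · rw [hg]
        rintro z (rfl | rfl)
        · exact mem_part_self Φ S _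
        · rw [hpart]; exact mem_part_self Φ S _
    · rw [hpart]; exact hs w e' h

theorem exists_isTopSwitching [Lattice G] [MulLeftMono G] [MulRightMono G] [Finite V]
    (Φ : GainGraph V E G) (S : Set E) : ∃ η, Φ.IsTopSwitching S η := by
  classical
  obtain ⟨p, hp⟩ := exists_potential Φ S
  have hglb : ∀ W : Set V, ∃ a : G, W.Nonempty → IsGLB (p '' W) a := by
    intro W
    by_cases hW : W.Nonempty
    · have hne : W.toFinite.toFinset.Nonempty := by simpa using hW
      refine ⟨W.toFinite.toFinset.inf' hne p, fun _ => ⟨?_, ?_⟩⟩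
      · rintro _ ⟨x, hx, rfl⟩
        exact Finset.inf'_le _ (by simpa using hx)
      · intro b hb
        refine Finset.le_inf' _ _ fun x hx => hb ⟨x, by simpa using hx, rfl⟩
    · exact ⟨1, fun h => absurd h hW⟩
  choose a ha using hglb
  refine ⟨fun v => if v ∈ Φ.balancedVerts S then p v * (a (Φ.part S v))⁻¹ else 1, ?_, ?_, ?_⟩
  · intro e he v w g hg hv
    have hpart : Φ.part S v = Φ.part S w := part_eq_of_arc he hg
    have hw : w ∈ Φ.balancedVerts S := by
      rw [mem_balancedVerts_iff, ← hpart]; exact mem_balancedVerts_iff.1 hv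
    have h1 := hp e he v w g hg hv
    simp only [hv, hw, if_true, ← hpart, mul_inv_rev, inv_inv]
    calc a (Φ.part S v) * (p v)⁻¹ * g * (p w * (a (Φ.part S v))⁻¹)
        = a (Φ.part S v) * ((p v)⁻¹ * g * p w) * (a (Φ.part S v))⁻¹ := by simp only [mul_assoc]
      _ = 1 := by rw [h1]; simp
  · intro W hW
    have hglb := ha W (nonempty_of_mem_parts hW.1)
    have hval : ∀ v ∈ W, (if v ∈ Φ.balancedVerts S then p v * (a (Φ.part S v))⁻¹ else 1) =
        p v * (a W)⁻¹ := by
      intro v hv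
      rw [if_pos ⟨W, hW, hv⟩, part_eq_of_mem hW.1 hv]
    constructor
    · rintro _ ⟨x, hx, rfl⟩
      simp only [hval x hx]
      exact le_mul_inv_iff_mul_le.2 (by simpa using hglb.1 ⟨x, hx, rfl⟩)
    · intro b hb
      have : b * a W ≤ a W := by
        refine hglb.2 ?_
        rintro _ ⟨x, hx, rfl⟩
        have := hb ⟨x, hx, rfl⟩
        simp only [hval x hx] at this
        exact le_mul_inv_iff_mul_le.1 this
      simpa using this
  · intro v hv
    simp [hv]

theorem IsTopSwitching.unique [Lattice G] [MulLeftMono G] [MulRightMono G]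
    {Φ : GainGraph V E G} {S : Set E} {η η' : V → G}
    (h : Φ.IsTopSwitching S η) (h' : Φ.IsTopSwitching S η') : η = η' := by
  funext v
  by_cases hv : v ∈ Φ.balancedVerts S
  · have hW := mem_balancedVerts_iff.1 hv
    have hconst : ∀ x y, (Φ.conn S).r x y →
        (x ∈ Φ.balancedVerts S ∨ y ∈ Φ.balancedVerts S) →
        (η x)⁻¹ * η' x = (η y)⁻¹ * η' y := by
      intro x y hxy
      induction hxy with
      | rel x y hxy =>
        intro hb
        obtain ⟨e, he, g, hg⟩ := hxy
        have hx : x ∈ Φ.balancedVerts S := by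
          rcases hb with hb | hb
          · exact hb
          · rw [mem_balancedVerts_iff, part_eq_of_arc he hg]; exact mem_balancedVerts_iff.1 hb
        have h1 := h.switching e he x y g hg hx
        have h2 := h'.switching e he x y g hg hx
        have e1 : (η x)⁻¹ = (η y)⁻¹ * g⁻¹ := by
          rw [mul_assoc] at h1; rw [eq_inv_of_mul_eq_one_left h1, mul_inv_rev]
        have e2 : η' x = g * η' y := by
          rw [mul_assoc] at h2; exact (inv_mul_eq_one.1 h2)
        rw [e1, e2]; group
      | refl x => intro _; rfl
      | symm x y _ ih => intro hb; exact (ih hb.symm).symm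
      | trans x y z hxy hyz ih ih' =>
        intro hb
        have p1 : Φ.part S x = Φ.part S y := part_eq_of_mem (part_mem_parts Φ S y) hxy
        have p2 : Φ.part S y = Φ.part S z := part_eq_of_mem (part_mem_parts Φ S z) hyz
        have hy : y ∈ Φ.balancedVerts S := by
          rw [mem_balancedVerts_iff]
          rcases hb with hb | hb
          · rw [← p1]; exact mem_balancedVerts_iff.1 hb
          · rw [p2]; exact mem_balancedVerts_iff.1 hb
        rw [ih (Or.inr hy), ih' (Or.inl hy)]
    have hval : ∀ x ∈ Φ.part S v, η' x = η x * ((η v)⁻¹ * η' v) := by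
      intro x hx
      rw [← hconst x v hx (Or.inr hv)]; group
    set α := (η v)⁻¹ * η' v with hα
    have g1 := h.meet _ hW
    have g2 := h'.meet _ hW
    have le1 : α ≤ 1 := by
      refine g2.2 ?_
      rintro _ ⟨x, hx, rfl⟩
      rw [hval x hx]
      exact le_mul_of_one_le_left' (g1.1 ⟨x, hx, rfl⟩)
    have le2 : α⁻¹ ≤ 1 := by
      refine g1.2 ?_
      rintro _ ⟨x, hx, rfl⟩
      have := g2.1 ⟨x, hx, rfl⟩
      rw [hval x hx] at this
      exact inv_le_iff_one_le_mul.2 this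
    have : α = 1 := le_antisymm le1 (by simpa using le2)
    rw [hα] at this
    exact inv_mul_eq_one.1 this
  · rw [h.off v hv, h'.off v hv]

end Existence

/-- The top switching function `η_S`. -/
noncomputable def topSwitching [Group G] [Lattice G] [MulLeftMono G] [MulRightMono G] [Finite V]
    (Φ : GainGraph V E G) (S : Set E) : V → G :=
  Classical.choose (exists_isTopSwitching Φ S)

/-- The vertex set `π_b(S)` of a contraction by `S`. -/
abbrev ContractVertex [Group G] (Φ : GainGraph V E G) (S : Set E) : Type _ :=
  {W : Set V // W ∈ Φ.balancedParts S}

open Classical in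
/-- The vertex of a contraction by `S` to which `v` is identified, if `v` belongs to a balanced
component of `S`; the other vertices are deleted. -/
noncomputable def contractVertex [Group G] (Φ : GainGraph V E G) (S : Set E) (v : V) :
    Option (Φ.ContractVertex S) :=
  if h : Φ.part S v ∈ Φ.balancedParts S then some ⟨Φ.part S v, h⟩ else none

/-- The contraction `Φ^η / S`: switch by `η`, delete the vertices outside `V_b(S)` (but not the edges
at them), identify each `W ∈ π_b(S)` to a single vertex, and delete `S`. -/
noncomputable def contractWith [Group G] (Φ : GainGraph V E G) (S : Set E) (η : V → G) :
    GainGraph (Φ.ContractVertex S) {e // e ∉ S} G where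
  edge e := ((Φ.switch η).edge e).collapse (Φ.contractVertex S)

/-- The top contraction `Φ / S`. -/
noncomputable def contract [Group G] [Lattice G] [MulLeftMono G] [MulRightMono G] [Finite V]
    (Φ : GainGraph V E G) (S : Set E) : GainGraph (Φ.ContractVertex S) {e // e ∉ S} G :=
  Φ.contractWith S (Φ.topSwitching S)

end GainGraph

/-- A right action of the group `G` on the abelian semigroup `W` by semigroup automorphisms: `h g` is
written `MulOpposite.op g • h`. -/
class GainAction (G : Type*) (W : Type*) [Group G] [AddCommSemigroup W] extends
    MulAction Gᵐᵒᵖ W where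
  op_smul_add : ∀ (g : G) (h h' : W),
    MulOpposite.op g • (h + h') = MulOpposite.op g • h + MulOpposite.op g • h'

/-- The sum of `f` over a nonempty finite set, in an abelian semigroup (which need not have a zero
element): it is computed after adjoining a new zero, which is not the sum of any nonempty family. -/
noncomputable def semigroupSum {V W : Type*} [AddCommSemigroup W] (s : Finset V) (hs : s.Nonempty)
    (f : V → W) : W :=
  WithZero.unzero (x := ∑ v ∈ s, (f v : WithZero W)) (by
    classical
    obtain ⟨a, ha⟩ := hs
    rw [← Finset.add_sum_erase s _ ha]
    cases h : (∑ v ∈ s.erase a, (f v : WithZero W)) with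
    | zero => simp
    | coe b => rw [← WithZero.coe_add]; exact WithZero.coe_ne_zero)

/-- A weighted gain graph `(Φ, h)`, with weights `h : V → W`. -/
structure WeightedGainGraph (V : Type*) (E : Type*) (G : Type*) (W : Type*) extends
    GainGraph V E G where
  weight : V → W

namespace WeightedGainGraph

variable {V E G W : Type*}

/-- Deleting the edge set `S`; the weights do not change. -/
def delete (Φ : WeightedGainGraph V E G W) (S : Set E) : WeightedGainGraph V {e // e ∉ S} G W where
  toGainGraph := Φ.toGainGraph.delete S
  weight := Φ.weight

/-- Switching both the gains and the weights: `h^η(v) = h(v) η(v)`. -/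
def switch [Group G] [AddCommSemigroup W] [GainAction G W] (Φ : WeightedGainGraph V E G W)
    (η : V → G) : WeightedGainGraph V E G W where
  toGainGraph := Φ.toGainGraph.switch η
  weight v := MulOpposite.op (η v) • Φ.weight v

/-- The contraction `(Φ / S, h / S)`, where `h / S (X)` is the sum of `h^{η_S}(v)` over `v ∈ X`. -/
noncomputable def contract [Group G] [Lattice G] [MulLeftMono G] [MulRightMono G]
    [AddCommSemigroup W] [GainAction G W] [Finite V] (Φ : WeightedGainGraph V E G W) (S : Set E) :
    WeightedGainGraph (Φ.ContractVertex S) {e // e ∉ S} G W where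
  toGainGraph := Φ.toGainGraph.contract S
  weight X := semigroupSum (X : Set V).toFinite.toFinset
    (by simpa using GainGraph.nonempty_of_mem_parts X.2.1) (Φ.switch (Φ.topSwitching S)).weight

/-- An isomorphism of weighted gain graphs: bijections of the vertices and of the edges that preserve
the kinds of the edges, the incidences, the gains (even the chosen reference directions) and the
weights. -/
structure Iso {V' E' : Type*} (Φ : WeightedGainGraph V E G W) (Ψ : WeightedGainGraph V' E' G W) where
  vertex : V ≃ V'
  edges : E ≃ E'
  edge_eq : ∀ e, Ψ.edge (edges e) = (Φ.edge e).map vertex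
  weight_eq : ∀ v, Ψ.weight (vertex v) = Φ.weight v

end WeightedGainGraph

namespace GainGraph

variable {V E G : Type*}

/-! Balance is handled by potentials instead of circles: a component is balanced exactly when it has
no half edge and some `p : V → G` switches all its gains to `1` (`mem_balancedParts_iff`). This is a
condition on single edges, so it passes easily to smaller edge sets, switched graphs, deletions and
contractions.

Vertices of an iterated contraction. A balanced component `Z` of `S` is a union of balanced
components of `Q`. If `p` is a potential for `S` on `Z`, then `η_Q⁻¹ p` is constant on each
component of `Q` in `Z` and descends to a potential for `R` in the contraction; conversely a
potential `q` there lifts to `η_Q q`. An edge of `R` that leaves `V_b(Q)` becomes a half edge and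
spoils balance in the contraction, so balanced components there are unions of vertices that no edge
of `S` leaves. Hence `setOf_subset_mem_balancedParts` and `sUnion_mem_balancedParts` give mutually
inverse maps.

Gains and weights. If `η_Q θ` switches `S` to `1`, then `θ` is constant on the components of `Q`.
Since `η_Q` has meet `1` on each of them and right multiplication preserves meets, `η_Q θ` and `θ`
have the same meet on `Z`. By uniqueness `η_S = η_Q θ` once the meet of `θ` is `1`
(`topSwitching_eq_mul`). Taking for `θ` the top switching function of `S` in the switched graph
gives the fourth claim; taking that of `R` in the contraction gives equality of gains, and of
weights after regrouping a sum. Deleting `R` changes nothing that `Q` sees, as the two are disjoint.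
-/

/-! ### Components and sets closed under adjacency. -/

theorem mem_iff_mem_of_conn {Φ : GainGraph V E G} {S : Set E} {U : Set V}
    (hU : ∀ v w, Φ.Adj S v w → (v ∈ U ↔ w ∈ U)) {x y : V} (h : (Φ.conn S).r x y) :
    x ∈ U ↔ y ∈ U := by
  induction h with
  | rel x y h => exact hU x y h
  | refl x => rfl
  | symm x y _ ih => exact ih.symm
  | trans x y z _ _ ih ih' => exact ih.trans ih'

theorem mem_iff_of_mem_parts {Φ : GainGraph V E G} {S : Set E} {W : Set V} (hW : W ∈ Φ.parts S)
    {x y : V} (h : (Φ.conn S).r x y) : x ∈ W ↔ y ∈ W := by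
  obtain ⟨z, rfl⟩ := hW
  exact ⟨fun hx => (Φ.conn S).trans ((Φ.conn S).symm h) hx, fun hy => (Φ.conn S).trans h hy⟩

theorem conn_of_mem_parts {Φ : GainGraph V E G} {S : Set E} {W : Set V} (hW : W ∈ Φ.parts S)
    {x y : V} (hx : x ∈ W) (hy : y ∈ W) : (Φ.conn S).r x y := by
  obtain ⟨z, rfl⟩ := hW
  exact (Φ.conn S).trans hx ((Φ.conn S).symm hy)

theorem Adj.conn {Φ : GainGraph V E G} {S : Set E} {v w : V} (h : Φ.Adj S v w) :
    (Φ.conn S).r v w :=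
  Relation.EqvGen.rel _ _ h

theorem mem_iff_of_arc {Φ : GainGraph V E G} {S : Set E} {W : Set V} (hW : W ∈ Φ.parts S)
    {e : E} (he : e ∈ S) {v w : V} {g : G} (h : Φ.edge e = EdgeData.arc v w g) :
    v ∈ W ↔ w ∈ W :=
  mem_iff_of_mem_parts hW (Adj.conn ⟨e, he, g, h⟩)

/-- A function that is preserved by the edges of a component is constant on it. -/
theorem eq_of_mem_parts {α : Type*} {Φ : GainGraph V E G} {S : Set E} {W : Set V}
    (hW : W ∈ Φ.parts S) {f : V → α}
    (hf : ∀ e ∈ S, ∀ v w g, Φ.edge e = EdgeData.arc v w g → v ∈ W → f v = f w)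
    {x y : V} (hx : x ∈ W) (hy : y ∈ W) : f x = f y := by
  have key := mem_iff_mem_of_conn (U := {z | z ∈ W ∧ f x = f z}) ?_ (conn_of_mem_parts hW hx hy)
  · exact (key.1 ⟨hx, rfl⟩).2
  · rintro v w ⟨e, he, g, hg⟩
    have hvw := mem_iff_of_arc hW he hg
    constructor
    · rintro ⟨hv, h⟩
      exact ⟨hvw.1 hv, h.trans (hf e he v w g hg hv)⟩
    · rintro ⟨hw, h⟩
      exact ⟨hvw.2 hw, h.trans (hf e he v w g hg (hvw.2 hw)).symm⟩

theorem conn_mono {Φ : GainGraph V E G} {Q S : Set E} (hQS : Q ⊆ S) {x y : V}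
    (h : (Φ.conn Q).r x y) : (Φ.conn S).r x y :=
  Relation.EqvGen.mono (fun _ _ ⟨e, he, h⟩ => ⟨e, hQS he, h⟩) _ _ h

theorem part_subset_of_mem {Φ : GainGraph V E G} {Q S : Set E} (hQS : Q ⊆ S) {Z : Set V}
    (hZ : Z ∈ Φ.parts S) {v : V} (hv : v ∈ Z) : Φ.part Q v ⊆ Z :=
  fun _ hx => (mem_iff_of_mem_parts hZ (conn_mono hQS hx)).2 hv

/-! ### Balance expressed by potentials. -/

variable [Group G]

/-- Each edge from `v` to `w` has gain `p v * (p w)⁻¹`, so the product telescopes; closed walks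
therefore have gain `1`. -/
theorem IsWalk.gain_eq {Φ : GainGraph V E G} {T : Set E} {p : V → G}
    (hp : ∀ e ∈ T, ∀ v w g, Φ.edge e = EdgeData.arc v w g → (p v)⁻¹ * g * p w = 1)
    {u v : V} {vs : List V} {es : List E} {g : G} (h : Φ.IsWalk u v vs es g) :
    (∀ e ∈ es, e ∈ T) → g = p u * (p v)⁻¹ := by
  induction h with
  | nil v => intro _; simp
  | @cons e u v w g g' vs es ht hw ih =>
    intro hes
    rw [ih fun e' h' => hes e' (List.mem_cons_of_mem _ h')]
    have heT : e ∈ T := hes e List.mem_cons_self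
    have hg : g = p u * (p v)⁻¹ := by
      rcases ht with h | h
      · have := hp e heT _ _ _ h
        rw [mul_assoc, inv_mul_eq_one] at this
        rw [this]; group
      · have := hp e heT _ _ _ h
        rw [mul_assoc, inv_mul_eq_one] at this
        rw [this]; group
    rw [hg]; group

/-- A component is balanced if and only if it has no half edges and its gains can be switched
to `1`. -/
theorem mem_balancedParts_iff {Φ : GainGraph V E G} {S : Set E} {W : Set V} :
    W ∈ Φ.balancedParts S ↔ W ∈ Φ.parts S ∧ (∀ e ∈ S, ∀ v ∈ W, Φ.edge e ≠ EdgeData.half v) ∧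
      ∃ p : V → G, ∀ e ∈ S, ∀ v w g, Φ.edge e = EdgeData.arc v w g → v ∈ W →
        (p v)⁻¹ * g * p w = 1 := by
  constructor
  · intro h
    refine ⟨h.1, ?_, ?_⟩
    · intro e he v hv hev
      refine h.2.1 e ⟨he, ?_, ?_⟩ v hev
      · rw [hev]; exact ⟨v, rfl⟩
      · rw [hev]; rintro _ rfl; exact hv
    · obtain ⟨p, hp⟩ := exists_potential Φ S
      exact ⟨p, fun e he v w g hg hv => hp e he v w g hg ⟨W, h, hv⟩⟩
  · rintro ⟨hW, hhalf, p, hp⟩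
    refine ⟨hW, ?_, ?_⟩
    · rintro e ⟨he, -, hsub⟩ v hev
      rw [hev] at hsub
      exact hhalf e he v (hsub rfl) hev
    · intro v vs es g hw _ _ _ hes
      rw [hw.gain_eq (T := Φ.induced S W) (p := p) ?_ hes, mul_inv_cancel]
      rintro e ⟨he, -, hsub⟩ v w g hg
      rw [hg] at hsub
      exact hp e he v w g hg (hsub (Or.inl rfl))

/-- A potential for `S` on `Z`, and the absence of half edges, are inherited by the smaller
component of `Q`. -/
theorem part_mem_balancedParts_of_subset {Φ : GainGraph V E G} {Q S : Set E} (hQS : Q ⊆ S)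
    {Z : Set V} (hZ : Z ∈ Φ.balancedParts S) {v : V} (hv : v ∈ Z) :
    Φ.part Q v ∈ Φ.balancedParts Q := by
  have hsub := part_subset_of_mem hQS hZ.1 hv
  obtain ⟨-, hhalf, p, hp⟩ := mem_balancedParts_iff.1 hZ
  exact mem_balancedParts_iff.2 ⟨part_mem_parts Φ Q v,
    fun e he x hx => hhalf e (hQS he) x (hsub hx),
    p, fun e he x w g hg hx => hp e (hQS he) x w g hg (hsub hx)⟩

theorem subset_balancedVerts_of_subset {Φ : GainGraph V E G} {Q S : Set E} (hQS : Q ⊆ S)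
    {Z : Set V} (hZ : Z ∈ Φ.balancedParts S) : Z ⊆ Φ.balancedVerts Q :=
  fun _ hv => mem_balancedVerts_iff.2 (part_mem_balancedParts_of_subset hQS hZ hv)

/-! ### Factoring the top switching function. -/

section Top

variable [Lattice G] [MulLeftMono G] [MulRightMono G]

theorem isTopSwitching_topSwitching [Finite V] (Φ : GainGraph V E G) (S : Set E) :
    Φ.IsTopSwitching S (Φ.topSwitching S) :=
  Classical.choose_spec (exists_isTopSwitching Φ S)

/-- A switching function for `S` that is the product of the top switching function for `Q ⊆ S` and
of a function with meet `1` on each balanced component is the top switching function for `S`. -/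
theorem topSwitching_eq_mul [Finite V] {Φ : GainGraph V E G} {Q S : Set E} (hQS : Q ⊆ S)
    {η θ : V → G} (hη : Φ.IsTopSwitching Q η)
    (hsw : ∀ e ∈ S, ∀ v w g, Φ.edge e = EdgeData.arc v w g → v ∈ Φ.balancedVerts S →
      (η v * θ v)⁻¹ * g * (η w * θ w) = 1)
    (hθ : ∀ Z ∈ Φ.balancedParts S, IsGLB (θ '' Z) 1) {v : V} (hv : v ∈ Φ.balancedVerts S) :
    Φ.topSwitching S v = η v * θ v := by
  classical
  -- Outside `V_b(S)` the product may differ from `1`, so it is cut off there to meet the convention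
  -- of `IsTopSwitching.off`.
  have key : Φ.IsTopSwitching S (fun v => if v ∈ Φ.balancedVerts S then η v * θ v else 1) := by
    refine ⟨?_, ?_, ?_⟩
    · intro e he v w g hg hv
      have hw : w ∈ Φ.balancedVerts S := by
        rw [mem_balancedVerts_iff, ← part_eq_of_arc he hg]; exact mem_balancedVerts_iff.1 hv
      simp only [hv, hw, if_true]
      exact hsw e he v w g hg hv
    · intro Z hZ
      have hval : (fun v => if v ∈ Φ.balancedVerts S then η v * θ v else 1) '' Z =
          (fun v => η v * θ v) '' Z :=
        Set.image_congr fun v hv => if_pos ⟨Z, hZ, hv⟩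
      rw [hval]
      have hpart := fun u (hu : u ∈ Z) => part_mem_balancedParts_of_subset hQS hZ hu
      constructor
      · rintro _ ⟨u, hu, rfl⟩
        exact one_le_mul ((hη.meet _ (hpart u hu)).1 ⟨u, mem_part_self Φ Q u, rfl⟩)
          ((hθ Z hZ).1 ⟨u, hu, rfl⟩)
      · intro b hb
        refine (hθ Z hZ).2 ?_
        rintro _ ⟨u, hu, rfl⟩
        have hsub := part_subset_of_mem hQS hZ.1 hu
        -- Both `η` and `η θ` switch the edges of `Q` in this component to `1`, so `θ` has equal
        -- values at their ends.
        have hconst : ∀ x ∈ Φ.part Q u, θ x = θ u := by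
          intro x hx
          refine eq_of_mem_parts (part_mem_parts Φ Q u) ?_ hx (mem_part_self Φ Q u)
          intro e he v w g hg hv
          have h1 := hη.switching e he v w g hg ⟨_, hpart u hu, hv⟩
          have h2 := hsw e (hQS he) v w g hg ⟨Z, hZ, hsub hv⟩
          have h3 : (θ v)⁻¹ * ((η v)⁻¹ * g * η w) * θ w = 1 := by
            rw [← h2]; group
          rwa [h1, mul_one, inv_mul_eq_one] at h3
        -- On the component of `u` the bound reads `b ≤ η x * θ u`; thus `b * (θ u)⁻¹` is a lower
        -- bound of `η` there, and the meet of `η` is `1`.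
        have : b * (θ u)⁻¹ ≤ 1 := by
          refine (hη.meet _ (hpart u hu)).2 ?_
          rintro _ ⟨x, hx, rfl⟩
          rw [mul_inv_le_iff_le_mul, ← hconst x hx]
          exact hb ⟨x, hsub hx, rfl⟩
        simpa using mul_inv_le_iff_le_mul.1 this
    · intro v hv
      simp [hv]
  rw [(isTopSwitching_topSwitching Φ S).unique key]
  exact if_pos hv

end Top

/-! ### Invariance of balance under switching; the fourth claim. -/

section Switch

theorem switch_edge_eq_arc {Φ : GainGraph V E G} {η : V → G} {e : E} {v w : V} {g : G} :
    (Φ.switch η).edge e = EdgeData.arc v w g ↔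
      Φ.edge e = EdgeData.arc v w (η v * g * (η w)⁻¹) := by
  change (Φ.edge e).switch η = _ ↔ _
  cases Φ.edge e with
  | loose => simp [EdgeData.switch]
  | half x => simp [EdgeData.switch]
  | arc x y k =>
    simp only [EdgeData.switch, EdgeData.arc.injEq]
    constructor
    · rintro ⟨rfl, rfl, rfl⟩; exact ⟨rfl, rfl, by group⟩
    · rintro ⟨rfl, rfl, rfl⟩; exact ⟨rfl, rfl, by group⟩

theorem switch_edge_eq_half {Φ : GainGraph V E G} {η : V → G} {e : E} {v : V} :
    (Φ.switch η).edge e = EdgeData.half v ↔ Φ.edge e = EdgeData.half v := by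
  change (Φ.edge e).switch η = _ ↔ _
  cases Φ.edge e <;> simp [EdgeData.switch]

theorem adj_switch (Φ : GainGraph V E G) (η : V → G) (S : Set E) :
    (Φ.switch η).Adj S = Φ.Adj S := by
  ext v w
  constructor
  · rintro ⟨e, he, g, hg⟩
    exact ⟨e, he, _, switch_edge_eq_arc.1 hg⟩
  · rintro ⟨e, he, g, hg⟩
    refine ⟨e, he, (η v)⁻¹ * g * η w, switch_edge_eq_arc.2 ?_⟩
    rw [hg]; congr 1; group

theorem parts_switch (Φ : GainGraph V E G) (η : V → G) (S : Set E) :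
    (Φ.switch η).parts S = Φ.parts S := by
  unfold parts conn
  rw [adj_switch]

/-- The potentials `p` of the switched graph correspond to the potentials `η p` of the original. -/
theorem balancedParts_switch (Φ : GainGraph V E G) (η : V → G) (S : Set E) :
    (Φ.switch η).balancedParts S = Φ.balancedParts S := by
  ext Z
  rw [mem_balancedParts_iff, mem_balancedParts_iff, parts_switch]
  simp only [ne_eq, switch_edge_eq_half]
  refine and_congr_right fun _ => and_congr_right fun _ => ?_
  constructor
  · rintro ⟨p, hp⟩
    refine ⟨fun v => η v * p v, fun e he v w g hg hv => ?_⟩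
    rw [← hp e he v w ((η v)⁻¹ * g * η w) (switch_edge_eq_arc.2 (by rw [hg]; congr 1; group)) hv]
    group
  · rintro ⟨p, hp⟩
    refine ⟨fun v => (η v)⁻¹ * p v, fun e he v w g hg hv => ?_⟩
    rw [← hp e he v w _ (switch_edge_eq_arc.1 hg) hv]
    group

theorem balancedVerts_switch (Φ : GainGraph V E G) (η : V → G) (S : Set E) :
    (Φ.switch η).balancedVerts S = Φ.balancedVerts S := by
  unfold balancedVerts
  rw [balancedParts_switch]

theorem topSwitching_eq_mul_topSwitching_switch [Lattice G] [MulLeftMono G] [MulRightMono G]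
    [Finite V] (Φ : GainGraph V E G) {Q S : Set E} (hQS : Q ⊆ S) {v : V}
    (hv : v ∈ Φ.balancedVerts S) :
    Φ.topSwitching S v =
      Φ.topSwitching Q v * (Φ.switch (Φ.topSwitching Q)).topSwitching S v := by
  have h' := isTopSwitching_topSwitching (Φ.switch (Φ.topSwitching Q)) S
  refine topSwitching_eq_mul hQS (isTopSwitching_topSwitching Φ Q) ?_ ?_ hv
  · intro e he v w g hg hv
    rw [← h'.switching e he v w ((Φ.topSwitching Q v)⁻¹ * g * Φ.topSwitching Q w)
      (switch_edge_eq_arc.2 (by rw [hg]; congr 1; group)) (by rwa [balancedVerts_switch])]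
    group
  · intro Z hZ
    exact h'.meet Z (by rwa [balancedParts_switch])

end Switch

/-! ### Balanced components of a contraction. Here `η` need not have meet `1`: balance only uses
that it switches `Q` to `1`. -/

section Contract

variable {Φ : GainGraph V E G} {Q R : Set E} {η : V → G}

theorem ContractVertex.eq_of_mem {X Y : Φ.ContractVertex Q} {v : V} (hX : v ∈ (X : Set V))
    (hY : v ∈ (Y : Set V)) : X = Y :=
  Subtype.ext ((part_eq_of_mem X.2.1 hX).symm.trans (part_eq_of_mem Y.2.1 hY))

theorem ContractVertex.nonempty (X : Φ.ContractVertex Q) : (X : Set V).Nonempty :=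
  nonempty_of_mem_parts X.2.1

theorem contractVertex_eq_some_iff {v : V} {X : Φ.ContractVertex Q} :
    Φ.contractVertex Q v = some X ↔ v ∈ (X : Set V) := by
  unfold contractVertex
  constructor
  · intro h
    split_ifs at h with hb
    obtain rfl := Option.some.inj h
    exact mem_part_self Φ Q v
  · intro h
    have hX := part_eq_of_mem X.2.1 h
    rw [dif_pos (by rw [hX]; exact X.2)]
    exact congrArg some (Subtype.ext hX)

theorem contractVertex_eq_none_iff {v : V} :
    Φ.contractVertex Q v = none ↔ v ∉ Φ.balancedVerts Q := by
  rw [mem_balancedVerts_iff]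
  unfold contractVertex
  split_ifs with hb <;> simp [hb]

theorem exists_contractVertex {v : V} (hv : v ∈ Φ.balancedVerts Q) :
    ∃ X : Φ.ContractVertex Q, v ∈ (X : Set V) := by
  obtain ⟨X, hX, hv⟩ := hv
  exact ⟨⟨X, hX⟩, hv⟩

theorem contractWith_edge_of_half {e : {e // e ∉ Q}} {v : V} {X : Φ.ContractVertex Q}
    (h : Φ.edge e = EdgeData.half v) (hv : v ∈ (X : Set V)) :
    (Φ.contractWith Q η).edge e = EdgeData.half X := by
  change ((Φ.edge e).switch η).collapse _ = _
  rw [h]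
  simp [EdgeData.switch, EdgeData.collapse, contractVertex_eq_some_iff.2 hv]

theorem contractWith_edge_of_arc {e : {e // e ∉ Q}} {v w : V} {g : G}
    {X Y : Φ.ContractVertex Q} (h : Φ.edge e = EdgeData.arc v w g) (hv : v ∈ (X : Set V))
    (hw : w ∈ (Y : Set V)) :
    (Φ.contractWith Q η).edge e = EdgeData.arc X Y ((η v)⁻¹ * g * η w) := by
  change ((Φ.edge e).switch η).collapse _ = _
  rw [h]
  simp [EdgeData.switch, EdgeData.collapse, contractVertex_eq_some_iff.2 hv,
    contractVertex_eq_some_iff.2 hw]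

/-- The half edge records that the edge led to a deleted vertex, and makes the component of `X`
unbalanced for any edge set containing it. -/
theorem contractWith_edge_of_arc_left {e : {e // e ∉ Q}} {v w : V} {g : G}
    {X : Φ.ContractVertex Q} (h : Φ.edge e = EdgeData.arc v w g) (hv : v ∈ (X : Set V))
    (hw : w ∉ Φ.balancedVerts Q) :
    (Φ.contractWith Q η).edge e = EdgeData.half X := by
  change ((Φ.edge e).switch η).collapse _ = _
  rw [h]
  simp [EdgeData.switch, EdgeData.collapse, contractVertex_eq_some_iff.2 hv,
    contractVertex_eq_none_iff.2 hw]

theorem contractWith_edge_of_arc_right {e : {e // e ∉ Q}} {v w : V} {g : G}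
    {X : Φ.ContractVertex Q} (h : Φ.edge e = EdgeData.arc v w g) (hv : v ∉ Φ.balancedVerts Q)
    (hw : w ∈ (X : Set V)) :
    (Φ.contractWith Q η).edge e = EdgeData.half X := by
  change ((Φ.edge e).switch η).collapse _ = _
  rw [h]
  simp [EdgeData.switch, EdgeData.collapse, contractVertex_eq_some_iff.2 hw,
    contractVertex_eq_none_iff.2 hv]

theorem exists_arc_of_contractWith_edge {e : {e // e ∉ Q}} {X Y : Φ.ContractVertex Q} {k : G}
    (h : (Φ.contractWith Q η).edge e = EdgeData.arc X Y k) :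
    ∃ v ∈ (X : Set V), ∃ w ∈ (Y : Set V), ∃ g, Φ.edge e = EdgeData.arc v w g ∧
      k = (η v)⁻¹ * g * η w := by
  change ((Φ.edge e).switch η).collapse _ = _ at h
  cases he : Φ.edge e with
  | loose => simp [he, EdgeData.switch, EdgeData.collapse] at h
  | half x =>
    cases hx : Φ.contractVertex Q x <;> simp [he, EdgeData.switch, EdgeData.collapse, hx] at h
  | arc v w g =>
    cases hx : Φ.contractVertex Q v <;> cases hy : Φ.contractVertex Q w <;>
      simp [he, EdgeData.switch, EdgeData.collapse, hx, hy] at h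
    obtain ⟨rfl, rfl, rfl⟩ := h
    exact ⟨v, contractVertex_eq_some_iff.1 hx, w, contractVertex_eq_some_iff.1 hy, g, rfl, rfl⟩

theorem exists_of_contractWith_edge_half {e : {e // e ∉ Q}} {X : Φ.ContractVertex Q}
    (h : (Φ.contractWith Q η).edge e = EdgeData.half X) :
    ∃ v ∈ (X : Set V), Φ.edge e = EdgeData.half v ∨ ∃ w ∉ Φ.balancedVerts Q, ∃ g,
      Φ.edge e = EdgeData.arc v w g ∨ Φ.edge e = EdgeData.arc w v g := by
  change ((Φ.edge e).switch η).collapse _ = _ at h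
  cases he : Φ.edge e with
  | loose => simp [he, EdgeData.switch, EdgeData.collapse] at h
  | half x =>
    cases hx : Φ.contractVertex Q x <;> simp [he, EdgeData.switch, EdgeData.collapse, hx] at h
    subst h
    exact ⟨x, contractVertex_eq_some_iff.1 hx, Or.inl rfl⟩
  | arc v w g =>
    cases hx : Φ.contractVertex Q v <;> cases hy : Φ.contractVertex Q w <;>
      simp [he, EdgeData.switch, EdgeData.collapse, hx, hy] at h
    · subst h
      exact ⟨w, contractVertex_eq_some_iff.1 hy,
        Or.inr ⟨v, contractVertex_eq_none_iff.1 hx, g, Or.inr rfl⟩⟩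
    · subst h
      exact ⟨v, contractVertex_eq_some_iff.1 hx,
        Or.inr ⟨w, contractVertex_eq_none_iff.1 hy, g, Or.inl rfl⟩⟩

/-- Connected vertices of a contraction consist of connected vertices of the gain graph. -/
theorem conn_of_conn_contractWith {X Y : Φ.ContractVertex Q}
    (h : ((Φ.contractWith Q η).conn (Subtype.val ⁻¹' R)).r X Y) :
    ∀ x ∈ (X : Set V), ∀ y ∈ (Y : Set V), (Φ.conn (Q ∪ R)).r x y := by
  have hin : ∀ (X : Φ.ContractVertex Q), ∀ x ∈ (X : Set V), ∀ y ∈ (X : Set V),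
      (Φ.conn (Q ∪ R)).r x y := fun X x hx y hy =>
    conn_mono Set.subset_union_left (conn_of_mem_parts X.2.1 hx hy)
  induction h with
  | rel X Y h =>
    obtain ⟨e, he, k, hk⟩ := h
    obtain ⟨v, hv, w, hw, g, hg, -⟩ := exists_arc_of_contractWith_edge hk
    intro x hx y hy
    exact (Φ.conn _).trans (hin X x hx v hv)
      ((Φ.conn _).trans (Adj.conn ⟨e, Or.inr he, g, hg⟩) (hin Y w hw y hy))
  | refl X => exact hin X
  | symm X Y _ ih => exact fun x hx y hy => (Φ.conn _).symm (ih y hy x hx)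
  | trans X Y Z _ _ ih ih' =>
    intro x hx z hz
    obtain ⟨y, hy⟩ := Y.nonempty
    exact (Φ.conn _).trans (ih x hx y hy) (ih' y hy z hz)

/-- Inside `Z ⊆ V_b(Q)` no vertex is deleted, so along a path each edge of `Q` stays within one
contracted vertex and each other edge survives as an arc. Without `hZQ` the path could be cut. -/
theorem conn_contractWith {Z : Set V} (hZ : Z ∈ Φ.parts (Q ∪ R)) (hZQ : Z ⊆ Φ.balancedVerts Q)
    {X Y : Φ.ContractVertex Q} {x y : V} (hx : x ∈ (X : Set V)) (hy : y ∈ (Y : Set V))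
    (hxZ : x ∈ Z) (hyZ : y ∈ Z) :
    ((Φ.contractWith Q η).conn (Subtype.val ⁻¹' R)).r X Y := by
  have key := mem_iff_mem_of_conn (U := {z | z ∈ Z ∧ ∃ Y : Φ.ContractVertex Q, z ∈ (Y : Set V) ∧
    ((Φ.contractWith Q η).conn (Subtype.val ⁻¹' R)).r X Y}) ?_ (conn_of_mem_parts hZ hxZ hyZ)
  · obtain ⟨-, Y', hY', h⟩ := key.1 ⟨hxZ, X, hx, Setoid.refl' _ X⟩
    rwa [ContractVertex.eq_of_mem hy hY']
  · rintro v w ⟨e, he, g, hg⟩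
    have hvw := mem_iff_of_arc hZ he hg
    by_cases hvZ : v ∈ Z
    swap
    · exact ⟨fun h => absurd h.1 hvZ, fun h => absurd (hvw.2 h.1) hvZ⟩
    have hwZ := hvw.1 hvZ
    obtain ⟨A, hA⟩ := exists_contractVertex (hZQ hvZ)
    obtain ⟨B, hB⟩ := exists_contractVertex (hZQ hwZ)
    have hAB : ((Φ.contractWith Q η).conn (Subtype.val ⁻¹' R)).r A B := by
      by_cases heQ : e ∈ Q
      · rw [ContractVertex.eq_of_mem ((mem_iff_of_arc A.2.1 heQ hg).1 hA) hB]
      · exact Adj.conn ⟨⟨e, heQ⟩, he.resolve_left heQ, _, contractWith_edge_of_arc hg hA hB⟩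
    constructor
    · rintro ⟨-, Y', hY', h⟩
      obtain rfl := ContractVertex.eq_of_mem hA hY'
      exact ⟨hwZ, B, hB, Setoid.trans' _ h hAB⟩
    · rintro ⟨-, Y', hY', h⟩
      obtain rfl := ContractVertex.eq_of_mem hB hY'
      exact ⟨hvZ, A, hA, Setoid.trans' _ h (Setoid.symm' _ hAB)⟩

/-- The potential on the contraction is `η⁻¹ p`, read off at an arbitrary representative `r X`; it
is constant on `X` because both `η` and `p` switch `Q` to `1` there. -/
theorem setOf_subset_mem_balancedParts
    (hη : ∀ e ∈ Q, ∀ v w g, Φ.edge e = EdgeData.arc v w g → v ∈ Φ.balancedVerts Q →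
      (η v)⁻¹ * g * η w = 1)
    {Z : Set V} (hZ : Z ∈ Φ.balancedParts (Q ∪ R)) :
    {X : Φ.ContractVertex Q | (X : Set V) ⊆ Z} ∈
      (Φ.contractWith Q η).balancedParts (Subtype.val ⁻¹' R) := by
  have hZQ := subset_balancedVerts_of_subset Set.subset_union_left hZ
  obtain ⟨-, hhalf, p, hp⟩ := mem_balancedParts_iff.1 hZ
  rw [mem_balancedParts_iff]
  refine ⟨?_, ?_, ?_⟩
  · obtain ⟨z, hz⟩ := nonempty_of_mem_parts hZ.1
    obtain ⟨A, hA⟩ := exists_contractVertex (hZQ hz)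
    refine ⟨A, ?_⟩
    ext X
    obtain ⟨x, hx⟩ := X.nonempty
    constructor
    · intro hX
      exact conn_contractWith hZ.1 hZQ hx hA (hX hx) hz
    · intro h y hy
      exact (mem_iff_of_mem_parts hZ.1 (conn_of_conn_contractWith h y hy z hA)).2 hz
  -- A half edge of the contraction at `X` is either a half edge of `S` in `Z`, or an edge from `Z`
  -- to a vertex outside `V_b(Q)`; but edges of `S` do not leave `Z`, which lies in `V_b(Q)`.
  · intro e he X hX h
    obtain ⟨v, hv, h | ⟨w, hw, g, h | h⟩⟩ := exists_of_contractWith_edge_half h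
    · exact hhalf e (Or.inr he) v (hX hv) h
    · exact hw (hZQ ((mem_iff_of_arc hZ.1 (Or.inr he) h).1 (hX hv)))
    · exact hw (hZQ ((mem_iff_of_arc hZ.1 (Or.inr he) h).2 (hX hv)))
  · choose r hr using fun X : Φ.ContractVertex Q => X.nonempty
    have hconst : ∀ X : Φ.ContractVertex Q, (X : Set V) ⊆ Z → ∀ x ∈ (X : Set V),
        (η x)⁻¹ * p x = (η (r X))⁻¹ * p (r X) := by
      intro X hX x hx
      refine eq_of_mem_parts (f := fun x => (η x)⁻¹ * p x) X.2.1 ?_ hx (hr X)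
      intro e he v w g hg hv
      have h1 := hη e he v w g hg ⟨X, X.2, hv⟩
      have h2 := hp e (Or.inl he) v w g hg (hX hv)
      rw [mul_assoc, inv_mul_eq_one] at h1 h2
      simp only [h1, h2]
      group
    refine ⟨fun X => (η (r X))⁻¹ * p (r X), ?_⟩
    intro e he X Y k hk hX
    obtain ⟨v, hv, w, hw, g, hg, rfl⟩ := exists_arc_of_contractWith_edge hk
    have hwZ : w ∈ Z := (mem_iff_of_arc hZ.1 (Or.inr he) hg).1 (hX hv)
    have hY : (Y : Set V) ⊆ Z := by
      rw [← part_eq_of_mem Y.2.1 hw]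
      exact part_subset_of_mem Set.subset_union_left hZ.1 hwZ
    beta_reduce
    rw [← hconst X hX v hv, ← hconst Y hY w hw, ← hp e (Or.inr he) v w g hg (hX hv)]
    group

/-- The absence of half edges in `Y` prevents edges of `R` from leaving the union, and a potential
`q` on `Y` lifts to `η q`. -/
theorem sUnion_mem_balancedParts
    (hη : ∀ e ∈ Q, ∀ v w g, Φ.edge e = EdgeData.arc v w g → v ∈ Φ.balancedVerts Q →
      (η v)⁻¹ * g * η w = 1)
    {Y : Set (Φ.ContractVertex Q)}
    (hY : Y ∈ (Φ.contractWith Q η).balancedParts (Subtype.val ⁻¹' R)) :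
    (⋃ X ∈ Y, (X : Set V)) ∈ Φ.balancedParts (Q ∪ R) := by
  obtain ⟨-, hhalf, q, hq⟩ := mem_balancedParts_iff.1 hY
  have hmem : ∀ {X : Φ.ContractVertex Q} {v : V}, v ∈ (X : Set V) →
      (v ∈ (⋃ X ∈ Y, (X : Set V)) ↔ X ∈ Y) := by
    intro X v hv
    rw [Set.mem_iUnion₂]
    constructor
    · rintro ⟨X', hX', hv'⟩
      rwa [ContractVertex.eq_of_mem hv hv']
    · intro hX
      exact ⟨X, hX, hv⟩
  have hbv : ∀ {v : V}, v ∈ (⋃ X ∈ Y, (X : Set V)) → v ∈ Φ.balancedVerts Q := by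
    intro v hv
    obtain ⟨X, -, hv⟩ := Set.mem_iUnion₂.1 hv
    exact ⟨X, X.2, hv⟩
  -- An edge of `R` with just one end in `V_b(Q)`, that end lying in the union, would be a half edge
  -- at a vertex of `Y`.
  have hboth : ∀ e ∈ Q ∪ R, ∀ v w g, Φ.edge e = EdgeData.arc v w g →
      (v ∈ (⋃ X ∈ Y, (X : Set V)) ∨ w ∈ (⋃ X ∈ Y, (X : Set V))) →
      v ∈ Φ.balancedVerts Q ∧ w ∈ Φ.balancedVerts Q := by
    intro e he v w g hg h
    by_cases heQ : e ∈ Q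
    · have hvw : v ∈ Φ.balancedVerts Q ↔ w ∈ Φ.balancedVerts Q := by
        rw [mem_balancedVerts_iff, mem_balancedVerts_iff, part_eq_of_arc heQ hg]
      rcases h with h | h
      · exact ⟨hbv h, hvw.1 (hbv h)⟩
      · exact ⟨hvw.2 (hbv h), hbv h⟩
    · have heR := he.resolve_left heQ
      rcases h with h | h
      · refine ⟨hbv h, by_contra fun hw => ?_⟩
        obtain ⟨X, hX, hv⟩ := Set.mem_iUnion₂.1 h
        exact hhalf ⟨e, heQ⟩ heR X hX (contractWith_edge_of_arc_left hg hv hw)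
      · refine ⟨by_contra fun hv => ?_, hbv h⟩
        obtain ⟨X, hX, hw⟩ := Set.mem_iUnion₂.1 h
        exact hhalf ⟨e, heQ⟩ heR X hX (contractWith_edge_of_arc_right hg hv hw)
  have hclosed : ∀ v w, Φ.Adj (Q ∪ R) v w →
      (v ∈ (⋃ X ∈ Y, (X : Set V)) ↔ w ∈ (⋃ X ∈ Y, (X : Set V))) := by
    rintro v w ⟨e, he, g, hg⟩
    by_cases h : v ∈ Φ.balancedVerts Q ∧ w ∈ Φ.balancedVerts Q
    · obtain ⟨A, hA⟩ := exists_contractVertex h.1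
      obtain ⟨B, hB⟩ := exists_contractVertex h.2
      rw [hmem hA, hmem hB]
      by_cases heQ : e ∈ Q
      · rw [ContractVertex.eq_of_mem ((mem_iff_of_arc A.2.1 heQ hg).1 hA) hB]
      · exact mem_iff_of_arc hY.1 (e := ⟨e, heQ⟩) (he.resolve_left heQ)
          (contractWith_edge_of_arc hg hA hB)
    · have := mt (hboth e he v w g hg) h
      push Not at this
      exact iff_of_false this.1 this.2
  rw [mem_balancedParts_iff]
  refine ⟨?_, ?_, ?_⟩
  · obtain ⟨A, hA⟩ := nonempty_of_mem_parts hY.1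
    obtain ⟨a, ha⟩ := A.nonempty
    refine ⟨a, Set.Subset.antisymm ?_ ?_⟩
    · intro v hv
      obtain ⟨X, hX, hv⟩ := Set.mem_iUnion₂.1 hv
      exact conn_of_conn_contractWith (conn_of_mem_parts hY.1 hX hA) v hv a ha
    · intro v hv
      exact (mem_iff_mem_of_conn hclosed hv).2 ((hmem ha).2 hA)
  · intro e he v hv h
    obtain ⟨X, hX, hvX⟩ := Set.mem_iUnion₂.1 hv
    by_cases heQ : e ∈ Q
    · exact (mem_balancedParts_iff.1 X.2).2.1 e heQ v hvX h
    · exact hhalf ⟨e, heQ⟩ (he.resolve_left heQ) X hX (contractWith_edge_of_half h hvX)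
  · classical
    -- The default `1` never enters: by `hboth` every edge concerned has both ends in `V_b(Q)`.
    refine ⟨fun v => η v * (Φ.contractVertex Q v).elim 1 q, ?_⟩
    intro e he v w g hg hv
    obtain ⟨h1, h2⟩ := hboth e he v w g hg (Or.inl hv)
    obtain ⟨A, hA⟩ := exists_contractVertex h1
    obtain ⟨B, hB⟩ := exists_contractVertex h2
    simp only [contractVertex_eq_some_iff.2 hA, contractVertex_eq_some_iff.2 hB, Option.elim_some]
    by_cases heQ : e ∈ Q
    · obtain rfl := ContractVertex.eq_of_mem ((mem_iff_of_arc A.2.1 heQ hg).1 hA) hB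
      have : (q A)⁻¹ * ((η v)⁻¹ * g * η w) * q A = 1 := by rw [hη e heQ v w g hg h1]; group
      rw [← this]; group
    · rw [← hq ⟨e, heQ⟩ (he.resolve_left heQ) A B _ (contractWith_edge_of_arc hg hA hB)
        ((hmem hA).1 hv)]
      group

end Contract

end GainGraph
-- Components of `Q` after deleting `R`.
namespace GainGraph

variable {V E G : Type*}

theorem adj_delete {Φ : GainGraph V E G} {Q R : Set E} (hdisj : Disjoint Q R) :
    (Φ.delete R).Adj (Subtype.val ⁻¹' Q) = Φ.Adj Q := by
  ext v w
  constructor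
  · rintro ⟨e, he, g, hg⟩
    exact ⟨e, he, g, hg⟩
  · rintro ⟨e, he, g, hg⟩
    exact ⟨⟨e, Set.disjoint_left.1 hdisj he⟩, he, g, hg⟩

theorem parts_delete {Φ : GainGraph V E G} {Q R : Set E} (hdisj : Disjoint Q R) :
    (Φ.delete R).parts (Subtype.val ⁻¹' Q) = Φ.parts Q := by
  unfold parts conn
  rw [adj_delete hdisj]

variable [Group G]

/-! ### Contracting twice: vertices, top switching functions and edges. -/

section Contract

variable {Φ : GainGraph V E G} {Q R : Set E} {η : V → G}

theorem ContractVertex.toFinset_nonempty [Finite V] (X : Φ.ContractVertex Q) :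
    (X : Set V).toFinite.toFinset.Nonempty := by
  simpa using X.nonempty

/-- The vertices of a contraction of a contraction are the vertices of the contraction by the
union. -/
def contractWithVertexEquiv (Φ : GainGraph V E G) (Q R : Set E) (η : V → G)
    (hη : ∀ e ∈ Q, ∀ v w g, Φ.edge e = EdgeData.arc v w g → v ∈ Φ.balancedVerts Q →
      (η v)⁻¹ * g * η w = 1) :
    (Φ.contractWith Q η).ContractVertex (Subtype.val ⁻¹' R) ≃ Φ.ContractVertex (Q ∪ R) where
  toFun Y := ⟨⋃ X ∈ (Y : Set (Φ.ContractVertex Q)), (X : Set V),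
    sUnion_mem_balancedParts hη Y.2⟩
  invFun Z := ⟨{X | (X : Set V) ⊆ (Z : Set V)}, setOf_subset_mem_balancedParts hη Z.2⟩
  left_inv Y := by
    refine Subtype.ext (Set.ext fun X => ⟨fun hX => ?_, fun hX => ?_⟩)
    · obtain ⟨x, hx⟩ := X.nonempty
      obtain ⟨X', hX', hx'⟩ := Set.mem_iUnion₂.1 (hX hx)
      rwa [ContractVertex.eq_of_mem hx hx']
    · exact Set.subset_biUnion_of_mem (u := fun X : Φ.ContractVertex Q => (X : Set V)) hX
  right_inv Z := by
    refine Subtype.ext (Set.Subset.antisymm (Set.iUnion₂_subset fun X hX => hX) fun z hz => ?_)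
    obtain ⟨X, hX⟩ := exists_contractVertex
      (subset_balancedVerts_of_subset Set.subset_union_left Z.2 hz)
    refine Set.mem_iUnion₂.2 ⟨X, ?_, hX⟩
    change (X : Set V) ⊆ Z
    rw [← part_eq_of_mem X.2.1 hX]
    exact part_subset_of_mem Set.subset_union_left Z.2.1 hz

theorem mem_contractWithVertexEquiv
    {hη : ∀ e ∈ Q, ∀ v w g, Φ.edge e = EdgeData.arc v w g → v ∈ Φ.balancedVerts Q →
      (η v)⁻¹ * g * η w = 1}
    {Y : (Φ.contractWith Q η).ContractVertex (Subtype.val ⁻¹' R)} {X : Φ.ContractVertex Q}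
    {v : V} (hv : v ∈ (X : Set V)) :
    v ∈ (contractWithVertexEquiv Φ Q R η hη Y : Set V) ↔ X ∈ (Y : Set (Φ.ContractVertex Q)) := by
  change v ∈ (⋃ X ∈ (Y : Set (Φ.ContractVertex Q)), (X : Set V)) ↔ _
  rw [Set.mem_iUnion₂]
  constructor
  · rintro ⟨X', hX', hv'⟩
    rwa [ContractVertex.eq_of_mem hv hv']
  · intro hX
    exact ⟨X, hX, hv⟩

/-- As partial maps, the two successive identifications compose to the single one. In particular the
vertices deleted at either stage are exactly those outside `V_b(Q ∪ R)`, so edges lose the same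
endpoints. -/
theorem contractVertex_union
    (hη : ∀ e ∈ Q, ∀ v w g, Φ.edge e = EdgeData.arc v w g → v ∈ Φ.balancedVerts Q →
      (η v)⁻¹ * g * η w = 1) (v : V) :
    Φ.contractVertex (Q ∪ R) v = (Φ.contractVertex Q v).bind fun X =>
      ((Φ.contractWith Q η).contractVertex (Subtype.val ⁻¹' R) X).map
        (contractWithVertexEquiv Φ Q R η hη) := by
  refine Option.ext fun Z => ?_
  rw [← Option.mem_def, ← Option.mem_def, Option.mem_def, contractVertex_eq_some_iff]
  simp only [Option.mem_def, Option.bind_eq_some_iff, Option.map_eq_some_iff,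
    contractVertex_eq_some_iff]
  constructor
  · intro hv
    obtain ⟨X, hX⟩ := exists_contractVertex
      (subset_balancedVerts_of_subset Set.subset_union_left Z.2 hv)
    refine ⟨X, hX, (contractWithVertexEquiv Φ Q R η hη).symm Z, ?_, Equiv.apply_symm_apply _ _⟩
    rw [← mem_contractWithVertexEquiv (hη := hη) hX, Equiv.apply_symm_apply]
    exact hv
  · rintro ⟨X, hX, Y, hY, rfl⟩
    exact (mem_contractWithVertexEquiv hX).2 hY

variable [Lattice G] [MulLeftMono G] [MulRightMono G] [Finite V]

/-- The top switching function of `Q ∪ R` in terms of the top switching functions of `Q` and of `R`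
in the contraction by `Q`. -/
theorem topSwitching_union {X : Φ.ContractVertex Q} {v : V} (hX : v ∈ (X : Set V))
    (hv : v ∈ Φ.balancedVerts (Q ∪ R)) :
    Φ.topSwitching (Q ∪ R) v =
      Φ.topSwitching Q v * (Φ.contract Q).topSwitching (Subtype.val ⁻¹' R) X := by
  have hη := isTopSwitching_topSwitching Φ Q
  have hq := isTopSwitching_topSwitching (Φ.contract Q) (Subtype.val ⁻¹' R)
  set η := Φ.topSwitching Q
  set q := (Φ.contract Q).topSwitching (Subtype.val ⁻¹' R)
  -- `q` pulled back to the original vertices; the default `1` is used only off `V_b(Q)`, hence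
  -- never on a balanced component of `Q ∪ R`.
  let θ : V → G := fun v => (Φ.contractVertex Q v).elim 1 q
  have hθ : ∀ {X : Φ.ContractVertex Q} {v : V}, v ∈ (X : Set V) → θ v = q X := by
    intro X v hv
    simp only [θ, contractVertex_eq_some_iff.2 hv, Option.elim_some]
  rw [← hθ hX]
  refine topSwitching_eq_mul Set.subset_union_left hη ?_ ?_ hv
  · rintro e he v w g hg ⟨Z, hZ, hvZ⟩
    have hZQ := subset_balancedVerts_of_subset Set.subset_union_left hZ
    have hwZ := (mem_iff_of_arc hZ.1 he hg).1 hvZ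
    obtain ⟨A, hA⟩ := exists_contractVertex (hZQ hvZ)
    obtain ⟨B, hB⟩ := exists_contractVertex (hZQ hwZ)
    rw [hθ hA, hθ hB]
    by_cases heQ : e ∈ Q
    · obtain rfl := ContractVertex.eq_of_mem ((mem_iff_of_arc A.2.1 heQ hg).1 hA) hB
      have : (q A)⁻¹ * ((η v)⁻¹ * g * η w) * q A = 1 := by
        rw [hη.switching e heQ v w g hg (hZQ hvZ)]; group
      rw [← this]; group
    · have h : (q A)⁻¹ * ((η v)⁻¹ * g * η w) * q B = 1 := by
        refine hq.switching ⟨e, heQ⟩ (he.resolve_left heQ) A B _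
          (contractWith_edge_of_arc hg hA hB)
          ⟨_, setOf_subset_mem_balancedParts hη.switching hZ, ?_⟩
        change (A : Set V) ⊆ Z
        rw [← part_eq_of_mem A.2.1 hA]
        exact part_subset_of_mem Set.subset_union_left hZ.1 hvZ
      rw [← h]
      group
  · intro Z hZ
    have hZQ := subset_balancedVerts_of_subset Set.subset_union_left hZ
    -- The components of `Q` inside `Z` form a balanced component of the contraction, so the meet of
    -- `θ` on `Z` is one that `q` normalizes to `1`.
    have himage : θ '' Z = q '' {X | (X : Set V) ⊆ Z} := by
      ext a
      constructor
      · rintro ⟨z, hz, rfl⟩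
        obtain ⟨A, hA⟩ := exists_contractVertex (hZQ hz)
        refine ⟨A, ?_, (hθ hA).symm⟩
        change (A : Set V) ⊆ Z
        rw [← part_eq_of_mem A.2.1 hA]
        exact part_subset_of_mem Set.subset_union_left hZ.1 hz
      · rintro ⟨X, hX, rfl⟩
        obtain ⟨x, hx⟩ := X.nonempty
        exact ⟨x, hX hx, hθ hx⟩
    rw [himage]
    exact hq.meet _ (setOf_subset_mem_balancedParts hη.switching hZ)

/-- The cases are which endpoints survive each stage. Gains matter only if both survive both stages;
then switching by `η_Q` and next by `q` is switching by `η_Q q`, which is `η_S`. -/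
theorem contract_union_edge (e : {e : {e // e ∉ Q} // e ∉ (Subtype.val ⁻¹' R : Set {e // e ∉ Q})})
    (he : (e : E) ∉ Q ∪ R) :
    (Φ.contract (Q ∪ R)).edge ⟨e, he⟩ =
      (((Φ.contract Q).contract (Subtype.val ⁻¹' R)).edge e).map
        (contractWithVertexEquiv Φ Q R (Φ.topSwitching Q)
          (isTopSwitching_topSwitching Φ Q).switching) := by
  have hc := contractVertex_union (R := R) (isTopSwitching_topSwitching Φ Q).switching
  have htop : ∀ (v : V) (X : Φ.ContractVertex Q), Φ.contractVertex Q v = some X →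
      ∀ Y, (Φ.contract Q).contractVertex (Subtype.val ⁻¹' R) X = some Y →
      Φ.topSwitching (Q ∪ R) v =
        Φ.topSwitching Q v * (Φ.contract Q).topSwitching (Subtype.val ⁻¹' R) X := by
    intro v X hX Y hY
    have hv := contractVertex_eq_some_iff.1 hX
    refine topSwitching_union hv ?_
    exact ⟨_, (contractWithVertexEquiv Φ Q R (Φ.topSwitching Q)
      (isTopSwitching_topSwitching Φ Q).switching Y).2,
      (mem_contractWithVertexEquiv hv).2 (contractVertex_eq_some_iff.1 hY)⟩
  change ((Φ.edge e).switch _).collapse _ =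
    (((((Φ.edge e).switch _).collapse _).switch _).collapse _).map _
  change ∀ v : V, Φ.contractVertex (Q ∪ R) v = (Φ.contractVertex Q v).bind fun X =>
      ((Φ.contract Q).contractVertex (Subtype.val ⁻¹' R) X).map
        (contractWithVertexEquiv Φ Q R (Φ.topSwitching Q)
          (isTopSwitching_topSwitching Φ Q).switching) at hc
  cases Φ.edge e with
  | loose => rfl
  | half v =>
    simp only [EdgeData.switch, EdgeData.collapse, hc]
    cases hX : Φ.contractVertex Q v with
    | none => rfl
    | some X =>
      simp only [Option.bind_some]
      cases (Φ.contract Q).contractVertex (Subtype.val ⁻¹' R) X <;> rfl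
  | arc v w g =>
    simp only [EdgeData.switch, EdgeData.collapse, hc]
    cases hX : Φ.contractVertex Q v with
    | none =>
      cases hY : Φ.contractVertex Q w with
      | none => rfl
      | some Y =>
        simp only [Option.bind_some, Option.bind_none]
        cases (Φ.contract Q).contractVertex (Subtype.val ⁻¹' R) Y <;> rfl
    | some X =>
      cases hY : Φ.contractVertex Q w with
      | none =>
        simp only [Option.bind_some, Option.bind_none]
        cases (Φ.contract Q).contractVertex (Subtype.val ⁻¹' R) X <;> rfl
      | some Y =>
        simp only [Option.bind_some]
        cases hX' : (Φ.contract Q).contractVertex (Subtype.val ⁻¹' R) X with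
        | none => cases (Φ.contract Q).contractVertex (Subtype.val ⁻¹' R) Y <;> rfl
        | some X' =>
          cases hY' : (Φ.contract Q).contractVertex (Subtype.val ⁻¹' R) Y with
          | none => rfl
          | some Y' =>
            change EdgeData.arc _ _ _ = EdgeData.arc _ _ _
            rw [htop v X hX X' hX', htop w Y hY Y' hY']
            congr 1
            group

end Contract

/-! ### Contraction after deletion. -/

section Delete

variable {Φ : GainGraph V E G} {Q R : Set E}

theorem balancedParts_delete (hdisj : Disjoint Q R) :
    (Φ.delete R).balancedParts (Subtype.val ⁻¹' Q) = Φ.balancedParts Q := by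
  -- By disjointness `Q` survives the deletion intact, so any condition imposed edge by edge on `Q`
  -- transfers.
  have hall : ∀ P : EdgeData V G → Prop,
      (∀ e ∈ (Subtype.val ⁻¹' Q : Set {e // e ∉ R}), P ((Φ.delete R).edge e)) ↔
        ∀ e ∈ Q, P (Φ.edge e) := fun P =>
    ⟨fun h e he => h ⟨e, Set.disjoint_left.1 hdisj he⟩ he, fun h e he => h e he⟩
  ext Z
  rw [mem_balancedParts_iff, mem_balancedParts_iff, parts_delete hdisj,
    hall fun d => ∀ v ∈ Z, d ≠ EdgeData.half v]
  refine and_congr_right fun _ => and_congr_right fun _ => exists_congr fun p => ?_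
  exact hall fun d => ∀ v w g, d = EdgeData.arc v w g → v ∈ Z → (p v)⁻¹ * g * p w = 1

theorem topSwitching_delete [Lattice G] [MulLeftMono G] [MulRightMono G] [Finite V]
    (hdisj : Disjoint Q R) :
    (Φ.delete R).topSwitching (Subtype.val ⁻¹' Q) = Φ.topSwitching Q := by
  have h := isTopSwitching_topSwitching Φ Q
  have hbv : (Φ.delete R).balancedVerts (Subtype.val ⁻¹' Q) = Φ.balancedVerts Q := by
    unfold balancedVerts
    rw [balancedParts_delete hdisj]
  refine (isTopSwitching_topSwitching _ _).unique ⟨?_, ?_, ?_⟩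
  · intro e he v w g hg hv
    exact h.switching e he v w g hg (hbv ▸ hv)
  · rw [balancedParts_delete hdisj]
    exact h.meet
  · rw [hbv]
    exact h.off

/-- Contracting by `Q` has the same vertices before and after the deletion of `R`. -/
def deleteVertexEquiv (Φ : GainGraph V E G) (hdisj : Disjoint Q R) :
    Φ.ContractVertex Q ≃ (Φ.delete R).ContractVertex (Subtype.val ⁻¹' Q) :=
  Equiv.subtypeEquivRight fun _ => by rw [balancedParts_delete hdisj]

theorem contractVertex_delete (hdisj : Disjoint Q R) (v : V) :
    (Φ.delete R).contractVertex (Subtype.val ⁻¹' Q) v =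
      (Φ.contractVertex Q v).map (deleteVertexEquiv Φ hdisj) := by
  cases h : Φ.contractVertex Q v with
  | none =>
    rw [contractVertex_eq_none_iff] at h
    rw [Option.map_none, contractVertex_eq_none_iff]
    unfold balancedVerts
    rwa [balancedParts_delete hdisj]
  | some X =>
    have hv : v ∈ (X : Set V) := contractVertex_eq_some_iff.1 h
    rw [Option.map_some, contractVertex_eq_some_iff]
    exact hv

end Delete

end GainGraph

namespace EdgeData

theorem collapse_map {V V' V'' G : Type*} (p : V → Option V') (f : V' → V'') (d : EdgeData V G) :
    d.collapse (fun v => (p v).map f) = (d.collapse p).map f := by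
  cases d with
  | loose => rfl
  | half v => cases h : p v <;> simp [collapse, map, h]
  | arc v w g => cases h : p v <;> cases h' : p w <;> simp [collapse, map, h, h']

end EdgeData

/-! ### Sums of weights. -/

section SemigroupSum

variable {V W : Type*} [AddCommSemigroup W]

/-- Equalities of weights are proved in `WithZero W`, where `Finset.sum` is available, and brought
back by injectivity of the coercion. -/
theorem coe_semigroupSum (s : Finset V) (hs : s.Nonempty) (f : V → W) :
    ((semigroupSum s hs f : W) : WithZero W) = ∑ v ∈ s, (f v : WithZero W) :=
  WithZero.coe_unzero _

theorem op_smul_semigroupSum {G : Type*} [Group G] [GainAction G W] (g : G) (s : Finset V)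
    (hs : s.Nonempty) (f : V → W) :
    MulOpposite.op g • semigroupSum s hs f =
      semigroupSum s hs fun v => MulOpposite.op g • f v := by
  induction hs using Finset.Nonempty.cons_induction with
  | singleton a =>
    have h : ∀ f : V → W, semigroupSum {a} (Finset.singleton_nonempty a) f = f a := fun f =>
      WithZero.coe_injective (by rw [coe_semigroupSum, Finset.sum_singleton])
    rw [h, h]
  | cons a s ha hs ih =>
    have h : ∀ f : V → W, semigroupSum (Finset.cons a s ha) (Finset.cons_nonempty ha) f =
        f a + semigroupSum s hs f := fun f => WithZero.coe_injective (by
      rw [coe_semigroupSum, Finset.sum_cons, WithZero.coe_add, coe_semigroupSum])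
    rw [h, h, GainAction.op_smul_add, ih]

end SemigroupSum

namespace WeightedGainGraph

variable {V E G W : Type*} [Group G] [Lattice G] [MulLeftMono G] [MulRightMono G]
  [AddCommSemigroup W] [GainAction G W] [Finite V]

theorem coe_contract_weight (Φ : WeightedGainGraph V E G W) (S : Set E) (X : Φ.ContractVertex S) :
    ((Φ.contract S).weight X : WithZero W) = ∑ v ∈ (X : Set V).toFinite.toFinset,
      ((MulOpposite.op (Φ.topSwitching S v) • Φ.weight v : W) : WithZero W) :=
  coe_semigroupSum _ X.toFinset_nonempty _

/-- Automorphisms distribute over the sum and `(h η) g = h (η g)`; this gives the summands the shape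
of the factorization of `η_S`. -/
theorem coe_op_smul_contract_weight (Φ : WeightedGainGraph V E G W) (S : Set E)
    (X : Φ.ContractVertex S) (g : G) :
    ((MulOpposite.op g • (Φ.contract S).weight X : W) : WithZero W) =
      ∑ v ∈ (X : Set V).toFinite.toFinset,
        ((MulOpposite.op (Φ.topSwitching S v * g) • Φ.weight v : W) : WithZero W) := by
  refine (congrArg _ (op_smul_semigroupSum g _ X.toFinset_nonempty _)).trans
    ((coe_semigroupSum _ X.toFinset_nonempty _).trans ?_)
  refine Finset.sum_congr rfl fun v _ => ?_
  rw [MulOpposite.op_mul, mul_smul]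
  rfl

end WeightedGainGraph

/-! ### The four claims. -/

theorem propositionP {V E G W : Type*} [Finite V]
    [Group G] [Lattice G] [MulLeftMono G] [MulRightMono G]
    [AddCommSemigroup W] [GainAction G W]
    (Φ : WeightedGainGraph V E G W) (Q R S : Set E) (hdisj : Disjoint Q R) (hS : S = Q ∪ R) :
    -- `(Φ / Q) / R = Φ / S` with `W'' = {X ∈ π_b(Q) | X ⊆ W}` and `W = ⋃ W''` identified
    (∃ F : WeightedGainGraph.Iso
        ((Φ.contract Q).contract (Subtype.val ⁻¹' R : Set {e // e ∉ Q})) (Φ.contract S),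
      (∀ Y, (F.vertex Y : Set V) = ⋃ X ∈ (Y : Set (Φ.ContractVertex Q)), (X : Set V)) ∧
      (∀ Z, ∀ X : Φ.ContractVertex Q, X ∈ (F.vertex.symm Z : Set (Φ.ContractVertex Q)) ↔
        (X : Set V) ⊆ (Z : Set V)) ∧
      (∀ e, ((F.edges e : {e // e ∉ S}) : E) = ((e : {e // e ∉ Q}) : E))) ∧
    -- `(Φ / Q) \ R = (Φ \ R) / Q`
    (∃ F : WeightedGainGraph.Iso
        ((Φ.contract Q).delete (Subtype.val ⁻¹' R : Set {e // e ∉ Q}))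
        ((Φ.delete R).contract (Subtype.val ⁻¹' Q : Set {e // e ∉ R})),
      (∀ X, (F.vertex X : Set V) = (X : Set V)) ∧
      (∀ e, (((F.edges e : {e : {e // e ∉ R} // e ∉ (Subtype.val ⁻¹' Q : Set {e // e ∉ R})}) :
        {e // e ∉ R}) : E) = ((e : {e // e ∉ Q}) : E))) ∧
    -- `(Φ \ Q) \ R = Φ \ S`
    (∃ F : WeightedGainGraph.Iso
        ((Φ.delete Q).delete (Subtype.val ⁻¹' R : Set {e // e ∉ Q})) (Φ.delete S),
      (∀ v, F.vertex v = v) ∧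
      (∀ e, ((F.edges e : {e // e ∉ S}) : E) = ((e : {e // e ∉ Q}) : E))) ∧
    -- `η_S = η_Q η'_S`, where `η'_S` is the top switching function for `S` in `Φ` switched by `η_Q`
    (∀ v ∈ Φ.balancedVerts S, Φ.topSwitching S v =
      Φ.topSwitching Q v * (Φ.toGainGraph.switch (Φ.topSwitching Q)).topSwitching S v) := by
  classical
  subst hS
  let edgesUnion : {e : {e // e ∉ Q} // e ∉ (Subtype.val ⁻¹' R : Set {e // e ∉ Q})} ≃
      {e // e ∉ Q ∪ R} :=
    { toFun := fun e => ⟨e, fun h => h.elim e.1.2 e.2⟩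
      invFun := fun e => ⟨⟨e, fun h => e.2 (Or.inl h)⟩, fun h => e.2 (Or.inr h)⟩
      left_inv := fun _ => rfl
      right_inv := fun _ => rfl }
  let edgesSwap : {e : {e // e ∉ Q} // e ∉ (Subtype.val ⁻¹' R : Set {e // e ∉ Q})} ≃
      {e : {e // e ∉ R} // e ∉ (Subtype.val ⁻¹' Q : Set {e // e ∉ R})} :=
    { toFun := fun e => ⟨⟨e, e.2⟩, e.1.2⟩
      invFun := fun e => ⟨⟨e, e.2⟩, e.1.2⟩
      left_inv := fun _ => rfl
      right_inv := fun _ => rfl }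
  refine ⟨⟨⟨GainGraph.contractWithVertexEquiv Φ.toGainGraph Q R (Φ.topSwitching Q)
      (GainGraph.isTopSwitching_topSwitching Φ.toGainGraph Q).switching, edgesUnion, ?_, ?_⟩,
      fun _ => rfl, fun _ _ => Iff.rfl, fun _ => rfl⟩,
    ⟨⟨GainGraph.deleteVertexEquiv Φ.toGainGraph hdisj, edgesSwap, ?_, ?_⟩,
      fun _ => rfl, fun _ => rfl⟩,
    ⟨⟨Equiv.refl V, edgesUnion, ?_, fun _ => rfl⟩, fun _ => rfl, fun _ => rfl⟩,
    fun v hv => Φ.toGainGraph.topSwitching_eq_mul_topSwitching_switch Set.subset_union_left hv⟩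
  · exact fun e => GainGraph.contract_union_edge e _
  · intro Y
    set Z := GainGraph.contractWithVertexEquiv Φ.toGainGraph Q R (Φ.topSwitching Q)
      (GainGraph.isTopSwitching_topSwitching Φ.toGainGraph Q).switching Y with hZ
    apply WithZero.coe_injective
    rw [WeightedGainGraph.coe_contract_weight, WeightedGainGraph.coe_contract_weight]
    -- `Z` is the disjoint union of the members of `Y`, so the weight of `Z` splits into a double
    -- sum to be compared term by term.
    have hunion : (Z : Set V).toFinite.toFinset =
        (Y : Set (Φ.ContractVertex Q)).toFinite.toFinset.biUnion
          fun X => (X : Set V).toFinite.toFinset := by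
      ext v
      simp only [Set.Finite.mem_toFinset, Finset.mem_biUnion]
      exact Set.mem_iUnion₂.trans (by simp only [exists_prop])
    rw [hunion, Finset.sum_biUnion]
    · refine Finset.sum_congr rfl fun X hX => ?_
      have hXY : X ∈ (Y : Set (Φ.ContractVertex Q)) := by simpa using hX
      rw [WeightedGainGraph.coe_op_smul_contract_weight]
      refine Finset.sum_congr rfl fun v hv => ?_
      have hvX : v ∈ (X : Set V) := by simpa using hv
      rw [GainGraph.topSwitching_union hvX
        ⟨Z, Z.2, (GainGraph.mem_contractWithVertexEquiv hvX).2 hXY⟩]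
      rfl
    · intro X _ X' _ hne
      refine Finset.disjoint_left.2 fun v hv hv' => hne ?_
      exact GainGraph.ContractVertex.eq_of_mem (v := v) (by simpa using hv) (by simpa using hv')
  · intro e
    -- Both sides switch and collapse the same edge of `Φ`; it remains to match the switching
    -- functions and the vertex identifications.
    change ((Φ.edge e).switch _).collapse _ = (((Φ.edge e).switch _).collapse _).map _
    rw [← EdgeData.collapse_map]
    congr 1
    · exact funext fun v => GainGraph.contractVertex_delete hdisj v
    · congr 1
      exact GainGraph.topSwitching_delete hdisj
  · intro X
    apply WithZero.coe_injective
    rw [WeightedGainGraph.coe_contract_weight]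
    refine Eq.trans (Finset.sum_congr rfl fun v _ => ?_)
      (WeightedGainGraph.coe_contract_weight Φ Q X).symm
    rw [← GainGraph.topSwitching_delete hdisj]
    rfl
  · intro e
    change Φ.edge e = (Φ.edge e).map id
    cases Φ.edge e <;> rfl
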